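/- All rings are commutative. Let $(R,\mathfrak m)$ be a Noetherian local ring of dimension $d$ and let $B$ be an $R$-algebra which is strict, i.e. $B\ne\mathfrak m B$. Let $v:B\to\mathbb R\cup\{\infty\}$ be a value map, i.e. $v(ab)=v(a)+v(b)$ and $v(a+b)\ge\min\{v(a),v(b)\}$ for all $a,b\in B$, and $v(0)=\infty$; assume that $v$ is not identically $\infty$. A $B$-module $M$ is called almost zero, written $M\approx 0$, if for every $m\in M$ and every $\varepsilon>0$ there is $b\in B$ with $bm=0$ and $v(b)<\varepsilon$. For a sequence $\underline x=x_1,\ldots,x_d$ in $R$ and $1\le i\le d$ write $\underline x_{i-1}=x_1,\ldots,x_{i-1}$; let $H_i(\underline x;B)$ denote Koszul homology, and let $H^i_{\mathfrak m}(B)$ denote local cohomology, i.e. the $i$-th cohomology of the Čech complex of $B$ with respect to a finite sequence of generators of $\mathfrak m$. Consider the following statements. (a) $\dfrac{\big((\underline x_{i-1})B:_B x_i\big)}{(\underline x_{i-1})B}\approx 0$ for $1\le i\le d$ and every system of parameters $\underline x=x_1,\ldots,x_d$ of $R$. (b) $H_i(\underline x;B)\approx 0$ for all $i>0$ and every system of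 parameters $\underline x=x_1,\ldots,x_d$ of $R$. (c) $H^i_{\mathfrak m}(B)\approx 0$ for all $i<d$. Then: (i) (a) $\Rightarrow$ (b) $\Rightarrow$ (c). (ii) Suppose that $v$ is normalized, i.e. $v(c)\ge 0$ for all $c\in B$ and $v(c)>0$ for every non-unit $c\in B$, that $B$ is quasilocal (it has exactly one maximal ideal), and that $B$ is coherent (every finitely generated ideal of $B$ is finitely presented). Then (c) implies that $B$ is a balanced big Cohen-Macaulay $R$-algebra, i.e. every system of parameters $x_1,\ldots,x_d$ of $R$ is a regular sequence on $B$: for each $1\le i\le d$, $x_i$ is a non-zero-divisor on $B/(\underline x_{i-1})B$, and $B/(\underline x)B\neq 0$. -/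

import Mathlib

universe u w

/-! ## Value maps and almost zero modules -/

/-- A value map on a ring `T`: a map `v : T → ℝ ∪ {∞}` with `v (a b) = v a + v b`,
`v (a + b) ≥ min (v a) (v b)` and `v 0 = ∞`.  Neither `T` is a domain nor is `v⁻¹ {∞} = 0`. -/
structure ValueMap (T : Type*) [CommRing T] where
  toFun : T → WithTop ℝ
  map_mul' : ∀ a b, toFun (a * b) = toFun a + toFun b
  min_le_map_add' : ∀ a b, min (toFun a) (toFun b) ≤ toFun (a + b)
  map_zero' : toFun 0 = ⊤

instance {T : Type*} [CommRing T] : CoeFun (ValueMap T) (fun _ => T → WithTop ℝ) :=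
  ⟨ValueMap.toFun⟩

/-- A value map is normalized if it is nonnegative, and positive on non-units. -/
def ValueMap.IsNormalized {T : Type*} [CommRing T] (v : ValueMap T) : Prop :=
  (∀ c, 0 ≤ v c) ∧ ∀ c, ¬ IsUnit c → 0 < v c

/-- `M` is almost zero with respect to `v`: every element of `M` is annihilated by elements of
arbitrarily small value. -/
def IsAlmostZero {T : Type*} [CommRing T] (v : ValueMap T)
    (M : Type*) [AddCommGroup M] [Module T M] : Prop :=
  ∀ m : M, ∀ ε : ℝ, 0 < ε → ∃ b : T, b • m = 0 ∧ v b < (ε : WithTop ℝ)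

/-! ## Coherent modules and rings -/

/-- A module is coherent if it is finitely generated and every finitely generated submodule is
finitely presented. -/
def IsCoherentModule (A : Type*) [CommRing A] (M : Type*) [AddCommGroup M] [Module A M] : Prop :=
  Module.Finite A M ∧ ∀ N : Submodule A M, N.FG → Module.FinitePresentation A N

/-- A ring is coherent if it is coherent as a module over itself. -/
def IsCoherentRing (A : Type*) [CommRing A] : Prop :=
  IsCoherentModule A A

/-! ## Strict modules, systems of parameters, balanced big Cohen-Macaulay modules -/

/-- A module `M` over a local ring `(R, 𝔪)` is strict if `M ≠ 𝔪 M`. -/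
def IsStrict (R : Type*) [CommRing R] [IsLocalRing R] (M : Type*) [AddCommGroup M] [Module R M] :
    Prop :=
  IsLocalRing.maximalIdeal R • (⊤ : Submodule R M) ≠ ⊤

/-- `x₁, …, x_d` is a system of parameters of the local ring `(R, 𝔪)`: `d = dim R`, and `𝔪` is the
radical of the ideal `(x₁, …, x_d)`. -/
def IsSystemOfParameters {R : Type*} [CommRing R] [IsLocalRing R] {d : ℕ} (x : Fin d → R) : Prop :=
  ringKrullDim R = d ∧ (Ideal.span (Set.range x)).radical = IsLocalRing.maximalIdeal R

/-- A strict module is balanced big Cohen-Macaulay if every system of parameters of `R` is a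
regular sequence on it (including `M / (x) M ≠ 0`). -/
def IsBalancedBigCohenMacaulay (R : Type*) [CommRing R] [IsLocalRing R]
    (M : Type*) [AddCommGroup M] [Module R M] : Prop :=
  IsStrict R M ∧ ∀ (d : ℕ) (x : Fin d → R), IsSystemOfParameters x →
    RingTheory.Sequence.IsRegular M (List.ofFn x)

/-! ## Colon quotients -/

/-- The ideal `(x₁, …, x_{i-1})`; with indices starting at `0`, it is generated by the `x j` with
`j < i`. -/
def initialIdeal {A : Type*} [CommRing A] {d : ℕ} (x : Fin d → A) (i : Fin d) : Ideal A :=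
  Ideal.span (x '' {j | j < i})

/-- The module `((x₁, …, x_{i-1}) : x_i) / (x₁, …, x_{i-1})`. -/
abbrev ColonQuotient {A : Type*} [CommRing A] {d : ℕ} (x : Fin d → A) (i : Fin d) : Type _ :=
  ↥((initialIdeal x i).colon {x i}) ⧸
    (initialIdeal x i).submoduleOf ((initialIdeal x i).colon {x i})

/-! ## Signs -/

/-- The sign `(-1) ^ #{t ∈ S | t < s}`. -/
def alternatingSign (A : Type*) [CommRing A] {n : ℕ} (S : Finset (Fin n)) (s : Fin n) : A :=
  (-1) ^ (S.filter (· < s)).card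

theorem alternatingSign_mul_insert {A : Type*} [CommRing A] {n : ℕ} (S : Finset (Fin n))
    {s t : Fin n} (hs : s ∉ S) (ht : t ∉ S) (h : s ≠ t) :
    alternatingSign A S s * alternatingSign A (insert s S) t =
      -(alternatingSign A S t * alternatingSign A (insert t S) s) := by
  unfold alternatingSign
  rw [Finset.filter_insert, Finset.filter_insert]
  rcases lt_or_gt_of_ne h with h | h
  · rw [if_pos h, if_neg h.not_gt, Finset.card_insert_of_notMem (by simp [hs])]
    ring
  · rw [if_neg h.not_gt, if_pos h, Finset.card_insert_of_notMem (by simp [ht])]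
    ring

/-! ## The Koszul complex and its homology -/

section Koszul

variable {A : Type u} [CommRing A] {n : ℕ} (x : Fin n → A) (M : Type w) [AddCommGroup M]
  [Module A M]

/-- The degree `i` part `K_i(x; M) = ⋀ⁱ(Aⁿ) ⊗ M` of the Koszul complex.  A family `f` stands for
`∑ e_S ⊗ f S`, where `e_S = e_{s₁} ∧ … ∧ e_{s_i}` for `S = {s₁ < … < s_i}`. -/
abbrev KoszulChain (n i : ℕ) (M : Type w) : Type w :=
  {S : Finset (Fin n) // S.card = i} → M

/-- The Koszul differential `K_{i+1}(x; M) → K_i(x; M)`,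
`e_{s₀} ∧ … ∧ e_{s_i} ⊗ m ↦ ∑ k, (-1) ^ k e_{s₀} ∧ … ê_{s_k} … ∧ e_{s_i} ⊗ x_{s_k} m`. -/
def koszulD (i : ℕ) : KoszulChain n (i + 1) M →ₗ[A] KoszulChain n i M :=
  LinearMap.pi fun S => ∑ s : {s : Fin n // s ∉ S.1},
    (alternatingSign A S.1 s * x s) •
      LinearMap.proj ⟨insert s.1 S.1, by rw [Finset.card_insert_of_notMem s.2, S.2]⟩

/-- The Koszul differentials compose to zero. -/
theorem koszulD_koszulD (i : ℕ) (f : KoszulChain n (i + 2) M) :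
    koszulD x M i (koszulD x M (i + 1) f) = 0 := by
  ext S
  simp only [koszulD, LinearMap.pi_apply, LinearMap.sum_apply, LinearMap.smul_apply,
    LinearMap.proj_apply, Finset.smul_sum, Pi.zero_apply, Finset.sum_sigma']
  refine Finset.sum_involution
    (fun p _ => ⟨⟨p.2.1, fun h => p.2.2 (Finset.mem_insert_of_mem h)⟩,
      ⟨p.1.1, fun h => (Finset.mem_insert.mp h).elim
        (fun h => p.2.2 (Finset.mem_insert.mpr (Or.inl h.symm))) p.1.2⟩⟩) ?_ ?_ ?_ ?_
  · rintro ⟨⟨s, hs⟩, ⟨t, ht⟩⟩ -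
    have hst : s ≠ t := fun h => ht (Finset.mem_insert.mpr (Or.inl h.symm))
    have ht' : t ∉ S.1 := fun h => ht (Finset.mem_insert_of_mem h)
    have key : ∀ (U V : {S : Finset (Fin n) // S.card = i + 2}), U.1 = V.1 → f U = f V :=
      fun U V h => congrArg f (Subtype.ext h)
    simp only [smul_smul]
    rw [key ⟨insert s (insert t S.1), _⟩ ⟨insert t (insert s S.1), by
        rw [Finset.card_insert_of_notMem ht, Finset.card_insert_of_notMem hs, S.2]⟩
      (Finset.insert_comm _ _ _)]
    rw [← add_smul]
    convert zero_smul A _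
    linear_combination (x s * x t) * alternatingSign_mul_insert (A := A) S.1 hs ht' hst
  · rintro ⟨⟨s, hs⟩, ⟨t, ht⟩⟩ - - h
    have h1 : t = s := congrArg (fun p => p.1.1) h
    exact ht (Finset.mem_insert.mpr (Or.inl h1))
  · simp
  · simp

/-- The cycles of degree `i` of the Koszul complex. -/
def koszulCycles : (i : ℕ) → Submodule A (KoszulChain n i M)
  | 0 => ⊤
  | i + 1 => LinearMap.ker (koszulD x M i)

/-- The Koszul homology module `H_i(x; M)`. -/
abbrev KoszulHomology (i : ℕ) : Type w :=
  ↥(koszulCycles x M i) ⧸ (LinearMap.range (koszulD x M i)).submoduleOf (koszulCycles x M i)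

end Koszul

/-! ## The Čech complex and local cohomology -/

section Cech

variable {A : Type u} [CommRing A] {n : ℕ} (y : Fin n → A) (M : Type w) [AddCommGroup M]
  [Module A M]

/-- The localization `M_a` of `M` at the powers of `a`. -/
abbrev AwayModule (a : A) : Type (max u w) :=
  LocalizedModule (Submonoid.powers a) M

/-- The canonical map `M_a → M_b` for `a ∣ b`. -/
noncomputable def awayMap {a b : A} (h : a ∣ b) : AwayModule M a →ₗ[A] AwayModule M b :=
  LocalizedModule.lift (Submonoid.powers a) (LocalizedModule.mkLinearMap (Submonoid.powers b) M)
    (by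
      rintro ⟨_, k, rfl⟩
      obtain ⟨c, rfl⟩ := h
      have hb := IsLocalizedModule.map_units
        (LocalizedModule.mkLinearMap (Submonoid.powers (a * c)) M)
        (⟨(a * c) ^ k, k, rfl⟩ : Submonoid.powers (a * c))
      simp only [mul_pow, map_mul] at hb
      exact (((Commute.all (a ^ k) (c ^ k)).map (algebraMap A _)).isUnit_mul_iff.mp hb).1)

theorem awayMap_awayMap {a b c : A} (h : a ∣ b) (h' : b ∣ c) (m : AwayModule M a) :
    awayMap M h' (awayMap M h m) = awayMap M (h.trans h') m := by
  have : awayMap M h' ∘ₗ awayMap M h = awayMap M (h.trans h') := by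
    apply IsLocalizedModule.ext (Submonoid.powers a) (LocalizedModule.mkLinearMap _ M)
    · rintro ⟨_, k, rfl⟩
      obtain ⟨d, rfl⟩ := h.trans h'
      have hb := IsLocalizedModule.map_units
        (LocalizedModule.mkLinearMap (Submonoid.powers (a * d)) M)
        (⟨(a * d) ^ k, k, rfl⟩ : Submonoid.powers (a * d))
      simp only [mul_pow, map_mul] at hb
      exact (((Commute.all (a ^ k) (d ^ k)).map (algebraMap A _)).isUnit_mul_iff.mp hb).1
    · ext m
      simp [awayMap]
  exact LinearMap.congr_fun this m

/-- The degree `i` part `∏_{s₁ < … < s_i} M_{y_{s₁} ⋯ y_{s_i}}` of the Čech complex of `M` with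
respect to `y`. -/
abbrev CechCochain (i : ℕ) : Type (max u w) :=
  (S : {S : Finset (Fin n) // S.card = i}) → AwayModule M (∏ s ∈ S.1, y s)

/-- The Čech differential: the component of `d f` at `S = {s₀ < … < s_i}` is
`∑ k, (-1) ^ k` times the image of `f (S \ {s_k})` under localization. -/
noncomputable def cechD (i : ℕ) : CechCochain y M i →ₗ[A] CechCochain y M (i + 1) :=
  LinearMap.pi fun S => ∑ s : {s : Fin n // s ∈ S.1},
    alternatingSign A S.1 s •
      (awayMap M (Finset.prod_dvd_prod_of_subset _ _ y (Finset.erase_subset s.1 S.1)) ∘ₗ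
        LinearMap.proj (φ := fun S : {S : Finset (Fin n) // S.card = i} =>
            AwayModule M (∏ s ∈ S.1, y s))
          ⟨S.1.erase s.1, by rw [Finset.card_erase_of_mem s.2, S.2, Nat.add_sub_cancel]⟩)

/-- The Čech differentials compose to zero. -/
theorem cechD_cechD (i : ℕ) (f : CechCochain y M i) :
    cechD y M (i + 1) (cechD y M i f) = 0 := by
  ext S
  simp only [cechD, LinearMap.pi_apply, LinearMap.sum_apply, LinearMap.smul_apply,
    LinearMap.proj_apply, Finset.smul_sum, Pi.zero_apply, LinearMap.comp_apply, map_sum, map_smul,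
    awayMap_awayMap, Finset.sum_sigma']
  refine Finset.sum_involution
    (fun p _ => ⟨⟨p.2.1, Finset.mem_of_mem_erase p.2.2⟩,
      ⟨p.1.1, Finset.mem_erase.mpr ⟨fun h => by simpa [h] using p.2.2, p.1.2⟩⟩⟩) ?_ ?_ ?_ ?_
  · rintro ⟨⟨s, hs⟩, ⟨t, ht⟩⟩ -
    have hst : s ≠ t := fun h => by simp [h] at ht
    have ht' : t ∈ S.1 := Finset.mem_of_mem_erase ht
    have key : ∀ (U V : {S : Finset (Fin n) // S.card = i}) (h : U = V)
      (hU : ∏ s ∈ U.1, y s ∣ ∏ s ∈ S.1, y s) (hV : ∏ s ∈ V.1, y s ∣ ∏ s ∈ S.1, y s),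
      awayMap M hU (f U) = awayMap M hV (f V) := by
      rintro U _ rfl _ _; rfl
    simp only [smul_smul]
    rw [key ⟨(S.1.erase t).erase s, _⟩ ⟨(S.1.erase s).erase t, by
        rw [Finset.card_erase_of_mem ht, Finset.card_erase_of_mem hs, S.2]; rfl⟩
      (Subtype.ext (Finset.erase_right_comm)) _
      (Finset.prod_dvd_prod_of_subset _ _ y ((Finset.erase_subset _ _).trans
        (Finset.erase_subset _ _))), ← add_smul]
    convert zero_smul A _
    have := alternatingSign_mul_insert (A := A) ((S.1.erase s).erase t) (s := s) (t := t) (by simp) (by simp) hst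
    have e1 : insert s ((S.1.erase s).erase t) = S.1.erase t := by
      rw [Finset.erase_right_comm, Finset.insert_erase (by simp [hst, hs])]
    have e2 : insert t ((S.1.erase s).erase t) = S.1.erase s := by
      rw [Finset.insert_erase (by simp [hst.symm, ht'])]
    have h1 : ∀ (U : Finset (Fin n)) r, alternatingSign A (U.erase r) r = alternatingSign A U r := by
      intro U r
      unfold alternatingSign
      congr 2; ext q; simp; grind
    rw [e1, e2, h1 S.1 s, h1 S.1 t, h1 (S.1.erase s) t, Finset.erase_right_comm, h1] at this
    linear_combination this
  · rintro ⟨⟨s, hs⟩, ⟨t, ht⟩⟩ - - h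
    simp only [Sigma.mk.injEq, Subtype.mk.injEq] at h
    simp [h.1] at ht
  · simp
  · simp

/-- The coboundaries of degree `i` of the Čech complex. -/
noncomputable def cechCoboundaries : (i : ℕ) → Submodule A (CechCochain y M i)
  | 0 => ⊥
  | i + 1 => LinearMap.range (cechD y M i)

/-- The `i`-th cohomology of the Čech complex of `M` with respect to `y`, which is the local
cohomology module of `M` with support in the ideal `(y₁, …, y_n)` (up to isomorphism, it
depends only on the radical of that ideal). -/
abbrev CechCohomology (i : ℕ) : Type (max u w) :=
  ↥(LinearMap.ker (cechD y M i)) ⧸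
    (cechCoboundaries y M i).submoduleOf (LinearMap.ker (cechD y M i))

end Cech

/-!
(a) ⇒ (b): contraction with the dual of `e_{k+1}` is a connecting map relating the Koszul homology
of `x₁, …, x_{k+1}` to that of `x₁, …, x_k`. By induction on `k` a cycle of positive degree of the
longer sequence is almost a boundary as soon as its contraction is; in degree one the contraction is
annihilated by `x_{k+1}` modulo `(x₁, …, x_k)`, so this is almost regularity of `x_{k+1}`.

(b) ⇒ (c): every Čech class is killed by powers `x_jᵗ` of the parameters. The Koszul complex of
these powers is almost exact, and dimension shifting along it shows that a class of degree `< d`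
killed by all `x_jᵗ` is almost zero.

(c) ⇒ regularity: dimension shifting in the other direction makes `H₁(x; B)` almost zero. For a
finitely generated submodule `L` of `Bⁿ` and `b` in its almost closure, the ideal `(L : b)` is
finitely generated by coherence and contains elements of arbitrarily small value, so it is the unit
ideal since `v` is normalized. Hence `H₁(x; B) = 0`, and by Nakayama's lemma `H₁` vanishes for all
initial segments of `x` as well, which means that `x` is regular.
-/

/-! ## Almost closures -/

section AlmostClosure

variable {A : Type*} [CommRing A]

/-- A value map that is not identically `∞`.  Equivalently `v 1 = 0`; for the value map that is
identically `∞` not even the zero module is almost zero. -/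
class ValueMap.IsNontrivial (v : ValueMap A) : Prop where
  exists_ne_top : ∃ a, v a ≠ ⊤

theorem ValueMap.map_one (v : ValueMap A) [v.IsNontrivial] : v 1 = 0 := by
  obtain ⟨a, ha⟩ := IsNontrivial.exists_ne_top (v := v)
  have h := v.map_mul' 1 a
  rw [one_mul] at h
  exact (WithTop.add_right_cancel ha (by rwa [zero_add])).symm

theorem ValueMap.map_mul_lt_of_lt_half (v : ValueMap A) {a b : A} {ε : ℝ}
    (ha : v a < (ε / 2 : ℝ)) (hb : v b < (ε / 2 : ℝ)) : v (a * b) < ε :=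
  calc v (a * b) = v a + v b := v.map_mul' a b
    _ < (ε / 2 : ℝ) + (ε / 2 : ℝ) := WithTop.add_lt_add ha hb
    _ = ε := by rw [← WithTop.coe_add, add_halves]

variable (v : ValueMap A) [v.IsNontrivial]

theorem ValueMap.map_one_lt {ε : ℝ} (hε : 0 < ε) : v 1 < ε := by
  rw [v.map_one]
  exact_mod_cast hε

variable {M N : Type*} [AddCommGroup M] [Module A M] [AddCommGroup N] [Module A N]

/-- The almost closure of a submodule `L`: the elements that are multiplied into `L` by elements of
arbitrarily small value. -/
def almostClosure (L : Submodule A M) : Submodule A M where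
  carrier := {m | ∀ ε : ℝ, 0 < ε → ∃ b : A, v b < ε ∧ b • m ∈ L}
  zero_mem' _ hε := ⟨1, v.map_one_lt hε, by simp⟩
  add_mem' {m m'} hm hm' ε hε := by
    obtain ⟨b, hb, hbm⟩ := hm (ε / 2) (half_pos hε)
    obtain ⟨c, hc, hcm⟩ := hm' (ε / 2) (half_pos hε)
    refine ⟨b * c, v.map_mul_lt_of_lt_half hb hc, ?_⟩
    rw [smul_add, mul_smul, mul_smul, smul_comm b c m]
    exact L.add_mem (L.smul_mem _ hbm) (L.smul_mem _ hcm)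
  smul_mem' a m hm ε hε := by
    obtain ⟨b, hb, hbm⟩ := hm ε hε
    exact ⟨b, hb, by rw [smul_comm]; exact L.smul_mem _ hbm⟩

theorem le_almostClosure (L : Submodule A M) : L ≤ almostClosure v L :=
  fun _ hm _ hε => ⟨1, v.map_one_lt hε, by simpa using hm⟩

theorem almostClosure_mono {L L' : Submodule A M} (h : L ≤ L') :
    almostClosure v L ≤ almostClosure v L' :=
  fun _ hm ε hε => let ⟨b, hb, hbm⟩ := hm ε hε; ⟨b, hb, h hbm⟩

theorem mem_almostClosure_of_smul_mem {L : Submodule A M} {m : M}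
    (h : ∀ ε : ℝ, 0 < ε → ∃ b : A, v b < ε ∧ b • m ∈ almostClosure v L) :
    m ∈ almostClosure v L := by
  intro ε hε
  obtain ⟨b, hb, hbm⟩ := h (ε / 2) (half_pos hε)
  obtain ⟨c, hc, hcm⟩ := hbm (ε / 2) (half_pos hε)
  exact ⟨c * b, v.map_mul_lt_of_lt_half hc hb, by rwa [mul_smul]⟩

theorem map_mem_almostClosure (f : M →ₗ[A] N) {L : Submodule A M} {L' : Submodule A N}
    (h : L ≤ L'.comap f) {m : M} (hm : m ∈ almostClosure v L) : f m ∈ almostClosure v L' :=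
  fun ε hε => let ⟨b, hb, hbm⟩ := hm ε hε; ⟨b, hb, by rw [← map_smul]; exact h hbm⟩

variable {v}

theorem isAlmostZero_quotient_iff (K L : Submodule A M) :
    IsAlmostZero v (↥K ⧸ L.submoduleOf K) ↔ K ≤ almostClosure v L := by
  have mk_smul_eq_zero (m : K) (b : A) :
      b • (Submodule.Quotient.mk m : K ⧸ L.submoduleOf K) = 0 ↔ b • (m : M) ∈ L := by
    rw [← Submodule.Quotient.mk_smul, Submodule.Quotient.mk_eq_zero]
    rfl
  constructor
  · intro h m hm ε hε
    obtain ⟨b, hb, hbv⟩ := h (Submodule.Quotient.mk ⟨m, hm⟩) ε hε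
    exact ⟨b, hbv, (mk_smul_eq_zero _ b).mp hb⟩
  · intro h m ε hε
    obtain ⟨m, rfl⟩ := Submodule.Quotient.mk_surjective _ m
    obtain ⟨b, hbv, hb⟩ := h m.2 ε hε
    exact ⟨b, (mk_smul_eq_zero _ b).mpr hb, hbv⟩

end AlmostClosure

/-! ## Coherent modules -/

section Coherent

variable {A : Type*} [CommRing A] {M N P : Type*} [AddCommGroup M] [Module A M]
  [AddCommGroup N] [Module A N] [AddCommGroup P] [Module A P]

theorem IsCoherentModule.fg_ker (hM : IsCoherentModule A M) [Module.Finite A P] (f : P →ₗ[A] M) :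
    (LinearMap.ker f).FG := by
  have := hM.2 (LinearMap.range f) (Module.Finite.iff_fg.mp inferInstance)
  rw [← LinearMap.ker_rangeRestrict]
  exact Module.FinitePresentation.fg_ker _ f.surjective_rangeRestrict

theorem IsCoherentModule.fg_inf_ker (hM : IsCoherentModule A M) {L : Submodule A P} (hL : L.FG)
    (f : P →ₗ[A] M) : (L ⊓ LinearMap.ker f).FG := by
  have := Module.Finite.iff_fg.mpr hL
  have h := (hM.fg_ker (f ∘ₗ L.subtype)).map L.subtype
  rwa [LinearMap.ker_comp, Submodule.map_comap_subtype] at h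

theorem IsCoherentModule.fg_comap_toSpanSingleton (hM : IsCoherentModule A M) {L : Submodule A M}
    (hL : L.FG) (m : M) : (L.comap (LinearMap.toSpanSingleton A M m)).FG := by
  have := Module.Finite.iff_fg.mpr hL
  convert (hM.fg_ker ((LinearMap.toSpanSingleton A M m).coprod L.subtype)).map
    (LinearMap.fst A A L) using 1
  ext a
  constructor
  · intro h
    exact ⟨(a, -⟨a • m, h⟩), by simp, rfl⟩
  · rintro ⟨⟨a, l⟩, h, rfl⟩
    rw [SetLike.mem_coe, LinearMap.mem_ker, LinearMap.coprod_apply] at h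
    rw [Submodule.mem_comap, LinearMap.fst_apply, eq_neg_of_add_eq_zero_left h]
    exact L.neg_mem l.2

theorem IsCoherentModule.of_equiv (hM : IsCoherentModule A M) (e : M ≃ₗ[A] N) :
    IsCoherentModule A N := by
  have := hM.1
  refine ⟨Module.Finite.equiv e, fun L hL => ?_⟩
  have := hM.2 (L.map e.symm.toLinearMap) (hL.map _)
  exact Module.FinitePresentation.of_equiv (e.symm.submoduleMap L).symm

theorem IsCoherentModule.prod (hM : IsCoherentModule A M) (hN : IsCoherentModule A N) :
    IsCoherentModule A (M × N) := by
  have := hM.1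
  have := hN.1
  refine ⟨inferInstance, fun L hL => ?_⟩
  have := Module.Finite.iff_fg.mpr hL
  let p : L →ₗ[A] M := LinearMap.fst A M N ∘ₗ L.subtype
  have := Module.Finite.iff_fg.mpr (hM.fg_ker p)
  let q : LinearMap.ker p →ₗ[A] N := LinearMap.snd A M N ∘ₗ L.subtype ∘ₗ (LinearMap.ker p).subtype
  have hq : Function.Injective q := fun a b hab =>
    Subtype.ext (Subtype.ext (Prod.ext (a.2.trans b.2.symm) hab))
  have := hM.2 (LinearMap.range p) (Module.Finite.iff_fg.mp inferInstance)
  have := hN.2 (LinearMap.range q) (Module.Finite.iff_fg.mp inferInstance)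
  have : Module.FinitePresentation A (LinearMap.ker p) :=
    (LinearEquiv.finitePresentation_iff (M := LinearMap.ker p)
      (LinearEquiv.ofInjective q hq)).mpr inferInstance
  have : Module.FinitePresentation A (LinearMap.ker p.rangeRestrict) := by
    rwa [LinearMap.ker_rangeRestrict]
  exact Module.finitePresentation_of_ker _ p.surjective_rangeRestrict

theorem IsCoherentModule.pi (hM : IsCoherentModule A M) (ι : Type*) [Finite ι] :
    IsCoherentModule A (ι → M) := by
  obtain ⟨n, ⟨e⟩⟩ := Finite.exists_equiv_fin ι
  suffices h : ∀ n, IsCoherentModule A (Fin n → M) from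
    (h n).of_equiv (LinearEquiv.funCongrLeft A M e)
  intro n
  induction n with
  | zero => exact ⟨inferInstance, fun _ _ => Module.finitePresentation_of_projective A _⟩
  | succ n ih => exact (hM.prod ih).of_equiv (Fin.consLinearEquiv A fun _ => M)

theorem ValueMap.IsNormalized.exists_pos_le_of_fg {v : ValueMap A} (hv : v.IsNormalized)
    {I : Ideal A} (hI : I.FG) (hI' : I ≠ ⊤) : ∃ ε : ℝ, 0 < ε ∧ ∀ a ∈ I, (ε : WithTop ℝ) ≤ v a := by
  obtain ⟨s, rfl⟩ := hI
  have hs : 0 < s.inf v := (Finset.lt_inf_iff (WithTop.coe_lt_top 0)).mpr fun a ha =>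
    hv.2 a fun hu => hI' (Ideal.eq_top_of_isUnit_mem _ (Ideal.subset_span ha) hu)
  obtain ⟨ε, hε, hεs⟩ := WithTop.lt_iff_exists_coe_btwn.mp hs
  refine ⟨ε, by exact_mod_cast hε, fun a ha => ?_⟩
  induction ha using Submodule.span_induction with
  | mem a ha => exact hεs.le.trans (Finset.inf_le ha)
  | zero => exact le_top.trans_eq v.map_zero'.symm
  | add a b _ _ ha hb => exact (le_min ha hb).trans (v.min_le_map_add' a b)
  | smul c a _ ha =>
    calc (ε : WithTop ℝ) ≤ v a := ha
      _ ≤ v c + v a := le_add_of_nonneg_left (hv.1 c)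
      _ = v (c • a) := (v.map_mul' c a).symm

theorem IsCoherentModule.almostClosure_le (hM : IsCoherentModule A M) {v : ValueMap A}
    [v.IsNontrivial] (hv : v.IsNormalized) {L : Submodule A M} (hL : L.FG) :
    almostClosure v L ≤ L := by
  intro m hm
  by_contra hmL
  have hI : L.comap (LinearMap.toSpanSingleton A M m) ≠ ⊤ := fun h =>
    hmL (by simpa using (Ideal.eq_top_iff_one _).mp h)
  obtain ⟨ε, hε, hεI⟩ := hv.exists_pos_le_of_fg (hM.fg_comap_toSpanSingleton hL m) hI
  obtain ⟨b, hb, hbm⟩ := hm ε hε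
  exact (hb.trans_le (hεI b hbm)).false

end Coherent

/-! ## Functoriality of the Čech complex -/

section CechFunctoriality

variable {A : Type*} [CommRing A] {M N P : Type*} [AddCommGroup M] [Module A M]
  [AddCommGroup N] [Module A N] [AddCommGroup P] [Module A P]

/-- The map `M_a → N_a` induced by a linear map `M → N`. -/
noncomputable abbrev awayModuleMap (a : A) :
    (M →ₗ[A] N) →ₗ[A] AwayModule M a →ₗ[A] AwayModule N a :=
  IsLocalizedModule.map (Submonoid.powers a) (LocalizedModule.mkLinearMap _ M)
    (LocalizedModule.mkLinearMap _ N)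

theorem isUnit_algebraMap_end_awayModule (M : Type*) [AddCommGroup M] [Module A M] {a b : A}
    (h : a ∣ b) (c : Submonoid.powers a) :
    IsUnit (algebraMap A (Module.End A (AwayModule M b)) c) := by
  obtain ⟨_, k, rfl⟩ := c
  obtain ⟨c, rfl⟩ := h
  have hac := IsLocalizedModule.map_units
    (LocalizedModule.mkLinearMap (Submonoid.powers (a * c)) M)
    (⟨(a * c) ^ k, k, rfl⟩ : Submonoid.powers (a * c))
  simp only [mul_pow, map_mul] at hac
  exact (((Commute.all (a ^ k) (c ^ k)).map (algebraMap A _)).isUnit_mul_iff.mp hac).1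

theorem awayMap_mkLinearMap {a b : A} (h : a ∣ b) (m : M) :
    awayMap M h (LocalizedModule.mkLinearMap (Submonoid.powers a) M m) =
      LocalizedModule.mkLinearMap (Submonoid.powers b) M m := by
  simp [awayMap]

theorem awayMap_awayModuleMap {a b : A} (h : a ∣ b) (f : M →ₗ[A] N) (m : AwayModule M a) :
    awayMap N h (awayModuleMap a f m) = awayModuleMap b f (awayMap M h m) := by
  suffices H : awayMap N h ∘ₗ awayModuleMap a f = awayModuleMap b f ∘ₗ awayMap M h from
    LinearMap.congr_fun H m
  refine IsLocalizedModule.ext (Submonoid.powers a) (LocalizedModule.mkLinearMap _ M)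
    (isUnit_algebraMap_end_awayModule N h) (LinearMap.ext fun m => ?_)
  simp only [LinearMap.comp_apply, IsLocalizedModule.map_apply, awayMap_mkLinearMap]

variable {n : ℕ} (y : Fin n → A)

/-- The map of Čech complexes induced by a linear map, in degree `q`. -/
noncomputable def cechMap (q : ℕ) :
    (M →ₗ[A] N) →ₗ[A] CechCochain y M q →ₗ[A] CechCochain y N q where
  toFun f := LinearMap.pi fun S => awayModuleMap (∏ s ∈ S.1, y s) f ∘ₗ LinearMap.proj S
  map_add' f g := by ext; simp
  map_smul' a f := by ext; simp

theorem cechMap_apply (q : ℕ) (f : M →ₗ[A] N) (z : CechCochain y M q) (S) :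
    cechMap y q f z S = awayModuleMap (∏ s ∈ S.1, y s) f (z S) := rfl

theorem cechMap_id (q : ℕ) : cechMap y q (LinearMap.id : M →ₗ[A] M) = LinearMap.id := by
  refine LinearMap.ext fun z => funext fun S => ?_
  rw [cechMap_apply, awayModuleMap, IsLocalizedModule.map_id]
  rfl

theorem cechMap_comp (q : ℕ) (f : M →ₗ[A] N) (g : N →ₗ[A] P) (z : CechCochain y M q) :
    cechMap y q (g ∘ₗ f) z = cechMap y q g (cechMap y q f z) := by
  ext S
  simp only [cechMap_apply, awayModuleMap, IsLocalizedModule.map_comp' _ _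
    (LocalizedModule.mkLinearMap (Submonoid.powers (∏ s ∈ S.1, y s)) N), LinearMap.comp_apply]

theorem cechD_cechMap (q : ℕ) (f : M →ₗ[A] N) (z : CechCochain y M q) :
    cechD y N q (cechMap y q f z) = cechMap y (q + 1) f (cechD y M q z) := by
  ext S
  rw [cechMap_apply]
  simp only [cechD, LinearMap.pi_apply, LinearMap.sum_apply, LinearMap.smul_apply,
    LinearMap.proj_apply, LinearMap.comp_apply, map_sum, map_smul, cechMap_apply,
    awayMap_awayModuleMap]

theorem cechMap_injective (q : ℕ) {f : M →ₗ[A] N} (hf : Function.Injective f) :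
    Function.Injective (cechMap y q f) := fun _ _ h =>
  funext fun S => IsLocalizedModule.map_injective _ _ _ f hf (congrFun h S)

theorem cechMap_surjective (q : ℕ) {f : M →ₗ[A] N} (hf : Function.Surjective f) :
    Function.Surjective (cechMap y q f) := fun z => by
  choose w hw using fun S : {S : Finset (Fin n) // S.card = q} =>
    IsLocalizedModule.map_surjective (Submonoid.powers (∏ s ∈ S.1, y s))
      (LocalizedModule.mkLinearMap (Submonoid.powers (∏ s ∈ S.1, y s)) M)
      (LocalizedModule.mkLinearMap (Submonoid.powers (∏ s ∈ S.1, y s)) N) f hf (z S)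
  exact ⟨w, funext hw⟩

theorem cechMap_exact (q : ℕ) {f : M →ₗ[A] N} {g : N →ₗ[A] P} (h : Function.Exact f g) :
    Function.Exact (cechMap y q f) (cechMap y q g) := by
  intro z
  have exact_apply (S : {S : Finset (Fin n) // S.card = q}) :=
    IsLocalizedModule.map_exact (Submonoid.powers (∏ s ∈ S.1, y s))
      (LocalizedModule.mkLinearMap (Submonoid.powers (∏ s ∈ S.1, y s)) M)
      (LocalizedModule.mkLinearMap (Submonoid.powers (∏ s ∈ S.1, y s)) N)
      (LocalizedModule.mkLinearMap (Submonoid.powers (∏ s ∈ S.1, y s)) P) f g h (z S)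
  constructor
  · intro hz
    choose w hw using fun S => (exact_apply S).mp (congrFun hz S)
    exact ⟨w, funext hw⟩
  · rintro ⟨w, rfl⟩
    exact funext fun S => (exact_apply S).mpr ⟨w S, rfl⟩

theorem cechMap_mem_ker_cechD {q : ℕ} (f : M →ₗ[A] N) {z : CechCochain y M q}
    (hz : z ∈ LinearMap.ker (cechD y M q)) : cechMap y q f z ∈ LinearMap.ker (cechD y N q) := by
  rw [LinearMap.mem_ker, cechD_cechMap, LinearMap.mem_ker.mp hz, map_zero]

theorem mem_ker_cechD_of_cechMap {q : ℕ} {f : M →ₗ[A] N} (hf : Function.Injective f)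
    {z : CechCochain y M q} (hz : cechMap y q f z ∈ LinearMap.ker (cechD y N q)) :
    z ∈ LinearMap.ker (cechD y M q) := by
  rw [LinearMap.mem_ker, cechD_cechMap] at hz
  exact cechMap_injective y (q + 1) hf (by rw [hz, map_zero])

theorem cechCoboundaries_le_ker (q : ℕ) : cechCoboundaries y M q ≤ LinearMap.ker (cechD y M q) := by
  cases q with
  | zero => exact bot_le
  | succ q =>
    rintro _ ⟨w, rfl⟩
    exact cechD_cechD y M q w

theorem cechCoboundaries_le_comap_cechMap (q : ℕ) (f : M →ₗ[A] N) :
    cechCoboundaries y M q ≤ (cechCoboundaries y N q).comap (cechMap y q f) := by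
  cases q with
  | zero => exact bot_le
  | succ q =>
    rintro _ ⟨w, rfl⟩
    exact ⟨cechMap y q f w, cechD_cechMap y q f w⟩

theorem cechCoboundaries_le_map_cechMap (q : ℕ) {f : M →ₗ[A] N} (hf : Function.Surjective f) :
    cechCoboundaries y N q ≤ (cechCoboundaries y M q).map (cechMap y q f) := by
  cases q with
  | zero => exact bot_le
  | succ q =>
    rintro _ ⟨w, rfl⟩
    obtain ⟨w, rfl⟩ := cechMap_surjective y q hf w
    exact ⟨_, ⟨w, rfl⟩, (cechD_cechMap y q f w).symm⟩

end CechFunctoriality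

/-! ## Almost vanishing of Čech cohomology -/

section CechAlmostInjective

variable {A : Type*} [CommRing A] {v : ValueMap A} [v.IsNontrivial] {n : ℕ} {y : Fin n → A}
  {M N P : Type*} [AddCommGroup M] [Module A M] [AddCommGroup N] [Module A N]
  [AddCommGroup P] [Module A P] {f : M →ₗ[A] N} {g : N →ₗ[A] P} {q : ℕ}

theorem isAlmostZero_cechCohomology_iff : IsAlmostZero v (CechCohomology y M q) ↔
    LinearMap.ker (cechD y M q) ≤ almostClosure v (cechCoboundaries y M q) :=
  isAlmostZero_quotient_iff _ _

theorem cechMap_mem_almostClosure (f : M →ₗ[A] N) {z : CechCochain y M q}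
    (hz : z ∈ almostClosure v (cechCoboundaries y M q)) :
    cechMap y q f z ∈ almostClosure v (cechCoboundaries y N q) :=
  map_mem_almostClosure v _ (cechCoboundaries_le_comap_cechMap y q f) hz

variable (v y f q) in
/-- The kernel of the map `Hᵠ(M) → Hᵠ(N)` of Čech cohomology modules induced by `f` is almost
zero. -/
def CechAlmostInjective : Prop :=
  ∀ z ∈ LinearMap.ker (cechD y M q), cechMap y q f z ∈ almostClosure v (cechCoboundaries y N q) →
    z ∈ almostClosure v (cechCoboundaries y M q)

theorem CechAlmostInjective.comp (hg : CechAlmostInjective v y g q)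
    (hf : CechAlmostInjective v y f q) : CechAlmostInjective v y (g ∘ₗ f) q := fun z hz hgz =>
  hf z hz (hg _ (cechMap_mem_ker_cechD y f hz) (by rwa [← cechMap_comp]))

theorem CechAlmostInjective.isAlmostZero (hf : CechAlmostInjective v y f q)
    (hN : IsAlmostZero v (CechCohomology y N q)) : IsAlmostZero v (CechCohomology y M q) :=
  isAlmostZero_cechCohomology_iff.mpr fun z hz =>
    hf z hz (isAlmostZero_cechCohomology_iff.mp hN (cechMap_mem_ker_cechD y f hz))

theorem CechAlmostInjective.of_surjective (hf : Function.Injective f) (hg : Function.Surjective g)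
    (h : Function.Exact f g) (hM : IsAlmostZero v (CechCohomology y M q)) :
    CechAlmostInjective v y g q := by
  intro z hz hgz
  refine mem_almostClosure_of_smul_mem v fun ε hε => ?_
  obtain ⟨b, hb, hbz⟩ := hgz ε hε
  obtain ⟨u, hu, hub⟩ := cechCoboundaries_le_map_cechMap y q hg hbz
  obtain ⟨t, ht⟩ := (cechMap_exact y q h (b • z - u)).mp (by
    rw [map_sub, map_smul, hub, sub_self])
  have ht_cocycle : t ∈ LinearMap.ker (cechD y M q) := mem_ker_cechD_of_cechMap y hf (by
    rw [ht]
    exact Submodule.sub_mem _ (Submodule.smul_mem _ _ hz) (cechCoboundaries_le_ker y q hu))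
  have hbzu : b • z - u ∈ almostClosure v (cechCoboundaries y N q) :=
    ht ▸ cechMap_mem_almostClosure f (isAlmostZero_cechCohomology_iff.mp hM ht_cocycle)
  exact ⟨b, hb, by simpa using add_mem hbzu (le_almostClosure v _ hu)⟩

theorem CechAlmostInjective.of_injective (hf : Function.Injective f) (hg : Function.Surjective g)
    (h : Function.Exact f g)
    (hP : ∀ p, p + 1 = q → IsAlmostZero v (CechCohomology y P p)) :
    CechAlmostInjective v y f q := by
  intro z _ hfz
  cases q with
  | zero =>
    intro ε hε
    obtain ⟨b, hb, hbz⟩ := hfz ε hε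
    rw [← map_smul] at hbz
    exact ⟨b, hb, cechMap_injective y 0 hf (hbz.trans (map_zero _).symm)⟩
  | succ p =>
    refine mem_almostClosure_of_smul_mem v fun ε hε => ?_
    obtain ⟨b, hb, w, hw⟩ := hfz ε hε
    refine ⟨b, hb, fun δ hδ => ?_⟩
    have hgw : cechMap y p g w ∈ LinearMap.ker (cechD y P p) := by
      rw [LinearMap.mem_ker, cechD_cechMap, hw, ← map_smul]
      exact (cechMap_exact y (p + 1) h _).mpr ⟨_, rfl⟩
    obtain ⟨c, hc, hcw⟩ := isAlmostZero_cechCohomology_iff.mp (hP p rfl) hgw δ hδ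
    obtain ⟨u, hu, huc⟩ := cechCoboundaries_le_map_cechMap y p hg hcw
    obtain ⟨t, ht⟩ := (cechMap_exact y p h (c • w - u)).mp (by
      rw [map_sub, map_smul, huc, sub_self])
    refine ⟨c, hc, t, cechMap_injective y (p + 1) hf ?_⟩
    calc cechMap y (p + 1) f (cechD y M p t)
        = cechD y N p (c • w - u) := by rw [← cechD_cechMap, ht]
      _ = c • b • cechMap y (p + 1) f z := by
        rw [map_sub, LinearMap.mem_ker.mp (cechCoboundaries_le_ker y p hu), sub_zero, map_smul, hw]
      _ = cechMap y (p + 1) f (c • b • z) := by rw [map_smul, map_smul]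

theorem isAlmostZero_cechCohomology_right (hf : Function.Injective f)
    (hg : Function.Surjective g) (h : Function.Exact f g)
    (hN : IsAlmostZero v (CechCohomology y N q))
    (hM : IsAlmostZero v (CechCohomology y M (q + 1))) :
    IsAlmostZero v (CechCohomology y P q) := by
  rw [isAlmostZero_cechCohomology_iff] at hM hN ⊢
  intro z hz
  obtain ⟨w, rfl⟩ := cechMap_surjective y q hg z
  refine mem_almostClosure_of_smul_mem v fun ε hε => ?_
  rw [LinearMap.mem_ker, cechD_cechMap] at hz
  obtain ⟨u, hu⟩ := (cechMap_exact y (q + 1) h _).mp hz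
  have hu_cocycle : u ∈ LinearMap.ker (cechD y M (q + 1)) :=
    mem_ker_cechD_of_cechMap y hf (by rw [hu]; exact cechD_cechD y N q w)
  obtain ⟨b, hb, t, ht⟩ := hM hu_cocycle ε hε
  have hbwt : b • w - cechMap y q f t ∈ LinearMap.ker (cechD y N q) := by
    rw [LinearMap.mem_ker, map_sub, map_smul, cechD_cechMap, ht, map_smul, hu, sub_self]
  have := cechMap_mem_almostClosure g (hN hbwt)
  rw [map_sub, (cechMap_exact y q h _).mpr ⟨t, rfl⟩, sub_zero, map_smul] at this
  exact ⟨b, hb, this⟩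

theorem IsAlmostZero.cechCohomology (hM : IsAlmostZero v M) (y : Fin n → A) (q : ℕ) :
    IsAlmostZero v (CechCohomology y M q) := by
  rw [isAlmostZero_cechCohomology_iff]
  intro z _
  rw [← LinearMap.sum_single_apply (φ := fun S : {S : Finset (Fin n) // S.card = q} =>
    AwayModule M (∏ s ∈ S.1, y s)) z]
  refine sum_mem fun S _ => map_mem_almostClosure v (L := ⊥) (LinearMap.single A
    (fun S : {S : Finset (Fin n) // S.card = q} => AwayModule M (∏ s ∈ S.1, y s)) S) bot_le ?_
  induction z S using LocalizedModule.induction_on with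
  | h m c =>
    intro ε hε
    obtain ⟨b, hb, hbv⟩ := hM m ε hε
    exact ⟨b, hbv, by rw [Submodule.mem_bot, LocalizedModule.smul'_mk, hb, LocalizedModule.zero_mk]⟩

theorem mem_almostClosure_cechCoboundaries_pi {ι : Type*} [Finite ι] {z : CechCochain y (ι → M) q}
    (h : ∀ i, cechMap y q (LinearMap.proj i) z ∈ almostClosure v (cechCoboundaries y M q)) :
    z ∈ almostClosure v (cechCoboundaries y (ι → M) q) := by
  classical
  have := Fintype.ofFinite ι
  have hz : z = ∑ i, cechMap y q (LinearMap.single A (fun _ => M) i)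
      (cechMap y q (LinearMap.proj i) z) := by
    have hid : ∑ i, LinearMap.single A (fun _ => M) i ∘ₗ LinearMap.proj i =
        (LinearMap.id : (ι → M) →ₗ[A] ι → M) :=
      LinearMap.ext fun m =>
        (LinearMap.sum_apply _ _ _).trans (LinearMap.sum_single_apply (φ := fun _ => M) m)
    simp only [← cechMap_comp, ← LinearMap.sum_apply, ← map_sum, hid, cechMap_id,
      LinearMap.id_apply]
  rw [hz]
  exact sum_mem fun i _ => cechMap_mem_almostClosure _ (h i)

theorem IsAlmostZero.cechCohomology_pi (hM : IsAlmostZero v (CechCohomology y M q))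
    (ι : Type*) [Finite ι] : IsAlmostZero v (CechCohomology y (ι → M) q) := by
  rw [isAlmostZero_cechCohomology_iff] at hM ⊢
  intro z hz
  exact mem_almostClosure_cechCoboundaries_pi fun i =>
    hM (cechMap_mem_ker_cechD y (LinearMap.proj i : (ι → M) →ₗ[A] M) hz)

end CechAlmostInjective

/-! ## Signs -/

section AlternatingSign

variable {A : Type*} [CommRing A] {n : ℕ}

theorem alternatingSign_mul_self (S : Finset (Fin n)) (s : Fin n) :
    alternatingSign A S s * alternatingSign A S s = 1 := by
  rw [alternatingSign, ← mul_pow, neg_one_mul, neg_neg, one_pow]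

theorem alternatingSign_erase_self (S : Finset (Fin n)) (s : Fin n) :
    alternatingSign A (S.erase s) s = alternatingSign A S s := by
  rw [alternatingSign, alternatingSign, Finset.filter_erase, Finset.erase_eq_of_notMem (by simp)]

theorem alternatingSign_insert_self (S : Finset (Fin n)) (s : Fin n) :
    alternatingSign A (insert s S) s = alternatingSign A S s := by
  rw [← alternatingSign_erase_self, Finset.erase_insert_eq_erase, alternatingSign_erase_self]

theorem alternatingSign_mul_insert_eq_neg_erase {S : Finset (Fin n)} {s t : Fin n} (hs : s ∉ S)
    (ht : t ∈ S) : alternatingSign A S s * alternatingSign A (insert s S) t =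
      -(alternatingSign A S t * alternatingSign A (S.erase t) s) := by
  have hst : s ≠ t := fun h => hs (h ▸ ht)
  have key := alternatingSign_mul_insert (A := A) (S.erase t) (s := s) (t := t)
    (fun h => hs (Finset.mem_of_mem_erase h)) (Finset.notMem_erase t S) hst
  rw [Finset.insert_erase ht, ← Finset.erase_insert_of_ne hst, alternatingSign_erase_self,
    alternatingSign_erase_self] at key
  have h1 := alternatingSign_mul_self (A := A) S t
  have h2 := alternatingSign_mul_self (A := A) (insert s S) t
  linear_combination alternatingSign A S t * alternatingSign A (insert s S) t * key -
    alternatingSign A S t * alternatingSign A (S.erase t) s * h2 -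
    alternatingSign A S s * alternatingSign A (insert s S) t * h1

end AlternatingSign

/-! ## Čech cohomology is torsion -/

section CechTorsion

variable {A : Type*} [CommRing A] {M : Type*} [AddCommGroup M] [Module A M]

theorem isLocalizedModule_away_awayMap {a b c : A} (h : a ∣ c) (hc : c = b * a) :
    IsLocalizedModule.Away b (awayMap M h) := by
  let ι_a := LocalizedModule.mkLinearMap (Submonoid.powers a) M
  let ι_c := LocalizedModule.mkLinearMap (Submonoid.powers c) M
  have bijective_a (k : ℕ) : Function.Bijective fun u : AwayModule M a => a ^ k • u :=
    (Module.End.isUnit_iff _).mp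
      (isUnit_algebraMap_end_awayModule M dvd_rfl (⟨a ^ k, k, rfl⟩ : Submonoid.powers a))
  have injective_c (k : ℕ) : Function.Injective fun u : AwayModule M c => a ^ k • u :=
    ((Module.End.isUnit_iff _).mp
      (isUnit_algebraMap_end_awayModule M h (⟨a ^ k, k, rfl⟩ : Submonoid.powers a))).1
  refine IsLocalizedModule.Away.mk_of_addCommGroup
    (isUnit_algebraMap_end_awayModule M (Dvd.intro a hc.symm)
      (⟨b, 1, pow_one b⟩ : Submonoid.powers b)) (fun u => ?_) (fun w hw => ?_)
  · obtain ⟨k, m, hm⟩ := IsLocalizedModule.Away.surj ι_c c u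
    obtain ⟨w, hw : a ^ k • w = ι_a m⟩ := (bijective_a k).2 (ι_a m)
    refine ⟨k, w, injective_c k ?_⟩
    calc a ^ k • b ^ k • u = ι_c m := by rw [smul_smul, ← mul_pow, mul_comm a, ← hc, hm]
      _ = a ^ k • awayMap M h w := by rw [← map_smul, hw, awayMap_mkLinearMap]
  · obtain ⟨k, m, hm⟩ := IsLocalizedModule.Away.surj ι_a a w
    have hm0 : ι_c m = ι_c 0 := by
      rw [← awayMap_mkLinearMap h, ← hm, map_smul, hw, smul_zero, map_zero]
    obtain ⟨N, hN⟩ := IsLocalizedModule.Away.exists_of_eq c hm0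
    refine ⟨N, (bijective_a (N + k)).1 ?_⟩
    calc a ^ (N + k) • b ^ N • w = (b * a) ^ N • a ^ k • w := by
          rw [smul_smul, smul_smul]; ring_nf
      _ = a ^ (N + k) • 0 := by rw [← hc, hm, ← map_smul, hN, smul_zero, map_zero, smul_zero]

variable {n : ℕ} {y : Fin n → A} {q : ℕ} {s : Fin n}

theorem cechD_apply_insert {z : CechCochain y M q} (hz : ∀ T, s ∈ T.1 → z T = 0)
    (T : {T : Finset (Fin n) // T.card = q}) (hT : s ∉ T.1) :
    cechD y M q z ⟨insert s T.1, by rw [Finset.card_insert_of_notMem hT, T.2]⟩ =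
      alternatingSign A (insert s T.1) s •
        awayMap M (Finset.prod_dvd_prod_of_subset _ _ y (Finset.subset_insert s T.1)) (z T) := by
  simp only [cechD, LinearMap.pi_apply, LinearMap.sum_apply, LinearMap.smul_apply,
    LinearMap.proj_apply, LinearMap.comp_apply]
  refine (Fintype.sum_eq_single ⟨s, Finset.mem_insert_self s T.1⟩ fun t hts => ?_).trans ?_
  · rw [hz _ (Finset.mem_erase.mpr ⟨fun h => hts (Subtype.ext h.symm),
      Finset.mem_insert_self s T.1⟩), map_zero, smul_zero]
  · have key : ∀ (U : {T : Finset (Fin n) // T.card = q}) (_ : U = T)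
        (hU : ∏ t ∈ U.1, y t ∣ ∏ t ∈ insert s T.1, y t),
        awayMap M hU (z U) = awayMap M (Finset.prod_dvd_prod_of_subset _ _ y
          (Finset.subset_insert s T.1)) (z T) := by
      rintro U rfl _; rfl
    rw [key ⟨(insert s T.1).erase s, by rw [Finset.erase_insert hT, T.2]⟩
      (Subtype.ext (Finset.erase_insert hT))]

variable (M y q s) in
/-- The product of the localization maps `M_{y_T} → M_{y_s y_T}` over all `T` of cardinality `q`
not containing `s`. -/
noncomputable def piAwayMapInsert :
    ((T : {T : {T : Finset (Fin n) // T.card = q} // s ∉ T.1}) →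
        AwayModule M (∏ t ∈ T.1.1, y t)) →ₗ[A]
      (T : {T : {T : Finset (Fin n) // T.card = q} // s ∉ T.1}) →
        AwayModule M (∏ t ∈ insert s T.1.1, y t) :=
  LinearMap.pi fun T =>
    awayMap M (Finset.prod_dvd_prod_of_subset _ _ y (Finset.subset_insert s T.1.1)) ∘ₗ
      LinearMap.proj T

variable (M y q s) in
theorem isLocalizedModule_away_piAwayMapInsert :
    IsLocalizedModule.Away (y s) (piAwayMapInsert M y q s) :=
  have (T : {T : {T : Finset (Fin n) // T.card = q} // s ∉ T.1}) :=
    isLocalizedModule_away_awayMap (M := M)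
      (Finset.prod_dvd_prod_of_subset _ _ y (Finset.subset_insert s T.1.1))
      (Finset.prod_insert T.2)
  IsLocalizedModule.pi (Submonoid.powers (y s)) _

theorem exists_pow_smul_eq_zero_of_mem_ker_cechD {z : CechCochain y M q}
    (hz : z ∈ LinearMap.ker (cechD y M q)) (hs : ∀ T, s ∈ T.1 → z T = 0) :
    ∃ N : ℕ, y s ^ N • z = 0 := by
  have := isLocalizedModule_away_piAwayMapInsert M y q s
  have hz0 : piAwayMapInsert M y q s (fun T => z T.1) = piAwayMapInsert M y q s 0 := by
    rw [map_zero]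
    ext T
    have h := congrArg (alternatingSign A (insert s T.1.1) s • ·)
      ((cechD_apply_insert hs T.1 T.2).symm.trans (congrFun (LinearMap.mem_ker.mp hz) _))
    simp only [smul_smul, alternatingSign_mul_self, one_smul, Pi.zero_apply, smul_zero] at h
    exact h
  obtain ⟨N, hN⟩ := IsLocalizedModule.Away.exists_of_eq (y s) hz0
  rw [smul_zero] at hN
  refine ⟨N, funext fun T => ?_⟩
  by_cases hT : s ∈ T.1
  · rw [Pi.smul_apply, hs T hT, smul_zero, Pi.zero_apply]
  · exact congrFun hN ⟨T, hT⟩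

theorem exists_cechD_apply_eq_pow_smul (z : CechCochain y M (q + 1)) (s : Fin n) :
    ∃ (N : ℕ) (w : CechCochain y M q), ∀ S, s ∈ S.1 → cechD y M q w S = y s ^ N • z S := by
  have := isLocalizedModule_away_piAwayMapInsert M y q s
  obtain ⟨N, w, hw⟩ := IsLocalizedModule.Away.surj (piAwayMapInsert M y q s) (y s)
    fun T => alternatingSign A (insert s T.1.1) s •
      z ⟨insert s T.1.1, by rw [Finset.card_insert_of_notMem T.2, T.1.2]⟩
  refine ⟨N, fun T => if hT : s ∈ T.1 then 0 else w ⟨T, hT⟩, ?_⟩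
  rintro ⟨S, hcard⟩ hS
  obtain ⟨T, hT, rfl⟩ : ∃ T, s ∉ T ∧ insert s T = S :=
    ⟨S.erase s, Finset.notMem_erase s S, Finset.insert_erase hS⟩
  have hTcard : T.card = q := by rwa [Finset.card_insert_of_notMem hT, add_left_inj] at hcard
  rw [cechD_apply_insert (fun T hT => dif_pos hT) ⟨T, hTcard⟩ hT, dif_neg hT]
  calc alternatingSign A (insert s T) s • piAwayMapInsert M y q s w ⟨⟨T, hTcard⟩, hT⟩
      = alternatingSign A (insert s T) s • y s ^ N • alternatingSign A (insert s T) s •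
          z ⟨insert s T, hcard⟩ := by rw [← hw]; rfl
    _ = y s ^ N • z ⟨insert s T, hcard⟩ := by
      rw [smul_comm, smul_smul (alternatingSign _ _ _), alternatingSign_mul_self, one_smul]

theorem exists_pow_smul_mem_cechCoboundaries {z : CechCochain y M q}
    (hz : z ∈ LinearMap.ker (cechD y M q)) (s : Fin n) :
    ∃ N : ℕ, y s ^ N • z ∈ cechCoboundaries y M q := by
  cases q with
  | zero =>
    refine exists_pow_smul_eq_zero_of_mem_ker_cechD hz fun T hT => ?_
    rw [Finset.card_eq_zero.mp T.2] at hT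
    exact absurd hT (Finset.notMem_empty s)
  | succ q =>
    obtain ⟨K, w, hw⟩ := exists_cechD_apply_eq_pow_smul z s
    obtain ⟨N, hN⟩ := exists_pow_smul_eq_zero_of_mem_ker_cechD (s := s)
      (sub_mem (Submodule.smul_mem _ (y s ^ K) hz) (cechD_cechD y M q w))
      fun S hS => by rw [Pi.sub_apply, Pi.smul_apply, hw S hS, sub_self]
    rw [smul_sub, sub_eq_zero, smul_smul, ← pow_add] at hN
    exact ⟨N + K, y s ^ N • w, by rw [map_smul, hN]⟩

theorem isAlmostZero_of_cechCohomology_zero {v : ValueMap A} [v.IsNontrivial]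
    (h : IsAlmostZero v (CechCohomology y M 0))
    (htors : ∀ (m : M) (s : Fin n), ∃ N : ℕ, y s ^ N • m = 0) : IsAlmostZero v M := by
  intro m
  let z : CechCochain y M 0 := fun S => LocalizedModule.mkLinearMap _ M m
  have hz : z ∈ LinearMap.ker (cechD y M 0) := by
    refine LinearMap.mem_ker.mpr (funext fun S => ?_)
    simp only [cechD, LinearMap.pi_apply, LinearMap.sum_apply, LinearMap.smul_apply,
      LinearMap.proj_apply, LinearMap.comp_apply, z]
    refine Finset.sum_eq_zero fun t _ => ?_
    obtain ⟨N, hN⟩ := htors m t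
    obtain ⟨c, hc⟩ := Finset.dvd_prod_of_mem y t.2
    refine (congrArg _ ((awayMap_mkLinearMap _ m).trans ?_)).trans (smul_zero _)
    refine (IsLocalizedModule.eq_zero_iff (Submonoid.powers (∏ s ∈ S.1, y s)) _).mpr
      ⟨⟨(∏ s ∈ S.1, y s) ^ N, N, rfl⟩, ?_⟩
    change (∏ s ∈ S.1, y s) ^ N • m = 0
    rw [hc, mul_pow, mul_comm, mul_smul, hN, smul_zero]
  intro ε hε
  obtain ⟨b, hb, hbz⟩ := isAlmostZero_cechCohomology_iff.mp h hz ε hε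
  have hbm : LocalizedModule.mkLinearMap (Submonoid.powers (∏ s ∈ (∅ : Finset (Fin n)), y s)) M
      (b • m) = 0 := (map_smul _ b m).trans (congrFun ((Submodule.mem_bot A).mp hbz) ⟨∅, rfl⟩)
  obtain ⟨⟨_, k, rfl⟩, hk : (∏ s ∈ (∅ : Finset (Fin n)), y s) ^ k • b • m = 0⟩ :=
    (IsLocalizedModule.eq_zero_iff
      (Submonoid.powers (∏ s ∈ (∅ : Finset (Fin n)), y s))
      (LocalizedModule.mkLinearMap _ M)).mp hbm
  exact ⟨b, by simpa using hk, hb⟩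

end CechTorsion

/-! ## The total Koszul complex -/

section TotalKoszul

variable {A : Type*} [CommRing A] {n : ℕ} {M : Type*} [AddCommGroup M] [Module A M]

variable (A) in
/-- Contraction with the dual of the basis element `e_s` on `⋀(Aⁿ) ⊗ M`. A family `F` stands for
`∑ e_S ⊗ F S`, as in `KoszulChain`, but with `S` of arbitrary cardinality. -/
def koszulContract (s : Fin n) : (Finset (Fin n) → M) →ₗ[A] (Finset (Fin n) → M) :=
  LinearMap.pi fun S => if s ∈ S then 0 else alternatingSign A S s • LinearMap.proj (insert s S)

variable (A) in
/-- Left multiplication by the basis element `e_s` on `⋀(Aⁿ) ⊗ M`. -/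
def koszulWedge (s : Fin n) : (Finset (Fin n) → M) →ₗ[A] (Finset (Fin n) → M) :=
  LinearMap.pi fun S => if s ∈ S then alternatingSign A S s • LinearMap.proj (S.erase s) else 0

theorem koszulContract_apply (s : Fin n) (F : Finset (Fin n) → M) (S : Finset (Fin n)) :
    koszulContract A s F S = if s ∈ S then 0 else alternatingSign A S s • F (insert s S) := by
  rw [koszulContract, LinearMap.pi_apply]
  split_ifs <;> rfl

theorem koszulWedge_apply (s : Fin n) (F : Finset (Fin n) → M) (S : Finset (Fin n)) :
    koszulWedge A s F S = if s ∈ S then alternatingSign A S s • F (S.erase s) else 0 := by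
  rw [koszulWedge, LinearMap.pi_apply]
  split_ifs <;> rfl

theorem koszulContract_koszulContract (s t : Fin n) (F : Finset (Fin n) → M) :
    koszulContract A s (koszulContract A t F) = -koszulContract A t (koszulContract A s F) := by
  ext S
  simp only [Pi.neg_apply, koszulContract_apply, Finset.mem_insert]
  by_cases hs : s ∈ S
  · simp [hs]
  by_cases ht : t ∈ S
  · simp [ht]
  rcases eq_or_ne s t with rfl | hst
  · simp
  · simp only [hs, ht, hst, hst.symm, or_self, if_false, smul_smul, Finset.insert_comm t s S,
      alternatingSign_mul_insert S hs ht hst, neg_smul]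

theorem koszulContract_koszulWedge_self (s : Fin n) (F : Finset (Fin n) → M) :
    koszulContract A s (koszulWedge A s F) + koszulWedge A s (koszulContract A s F) = F := by
  ext S
  rw [Pi.add_apply, koszulContract_apply, koszulWedge_apply s (koszulContract A s F)]
  by_cases hs : s ∈ S
  · rw [if_pos hs, if_pos hs, koszulContract_apply, if_neg (Finset.notMem_erase s S), zero_add,
      smul_smul, alternatingSign_erase_self, alternatingSign_mul_self, one_smul,
      Finset.insert_erase hs]
  · rw [if_neg hs, if_neg hs, koszulWedge_apply, if_pos (Finset.mem_insert_self s S), add_zero,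
      smul_smul, alternatingSign_insert_self, alternatingSign_mul_self, one_smul,
      Finset.erase_insert hs]

theorem koszulContract_koszulWedge_of_ne {s t : Fin n} (hst : s ≠ t) (F : Finset (Fin n) → M) :
    koszulContract A s (koszulWedge A t F) = -koszulWedge A t (koszulContract A s F) := by
  ext S
  simp only [Pi.neg_apply, koszulContract_apply, koszulWedge_apply, Finset.mem_insert,
    Finset.mem_erase]
  by_cases hs : s ∈ S
  · simp [hs, hst]
  by_cases ht : t ∈ S
  · simp only [hs, ht, and_false, or_true, if_false, if_true, smul_smul,
      alternatingSign_mul_insert_eq_neg_erase hs ht, neg_smul, Finset.erase_insert_of_ne hst]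
  · simp [hs, ht, hst.symm]

variable (x : Fin n → A)

/-- The Koszul differential on the direct sum of all `K_i(x; M)`. -/
def totalKoszulD : (Finset (Fin n) → M) →ₗ[A] (Finset (Fin n) → M) :=
  ∑ s, x s • koszulContract A s

theorem totalKoszulD_apply (F : Finset (Fin n) → M) :
    totalKoszulD x F = ∑ s, x s • koszulContract A s F := by
  simp only [totalKoszulD, LinearMap.sum_apply, LinearMap.smul_apply]

theorem totalKoszulD_koszulContract (s : Fin n) (F : Finset (Fin n) → M) :
    totalKoszulD x (koszulContract A s F) = -koszulContract A s (totalKoszulD x F) := by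
  simp only [totalKoszulD_apply, map_sum, map_smul, koszulContract_koszulContract _ s F, smul_neg,
    Finset.sum_neg_distrib]

theorem totalKoszulD_koszulWedge (s : Fin n) (F : Finset (Fin n) → M) :
    totalKoszulD x (koszulWedge A s F) = x s • F - koszulWedge A s (totalKoszulD x F) := by
  have key (t : Fin n) : x t • koszulContract A t (koszulWedge A s F) =
      (if s = t then x t • F else 0) - x t • koszulWedge A s (koszulContract A t F) := by
    split_ifs with h
    · rw [← h, eq_sub_iff_add_eq, ← smul_add, koszulContract_koszulWedge_self]
    · rw [koszulContract_koszulWedge_of_ne (Ne.symm h), smul_neg, zero_sub]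
  simp only [totalKoszulD_apply, map_sum, map_smul, key, Finset.sum_sub_distrib,
    Finset.sum_ite_eq, Finset.mem_univ, if_true]

theorem totalKoszulD_sub_koszulWedge_koszulContract {s : Fin n} {F : Finset (Fin n) → M}
    (h : koszulContract A s (totalKoszulD x F) = 0) :
    totalKoszulD x (F - koszulWedge A s (koszulContract A s F)) =
      totalKoszulD x F - x s • koszulContract A s F := by
  rw [map_sub, totalKoszulD_koszulWedge, totalKoszulD_koszulContract, h, neg_zero, map_zero,
    sub_zero]

end TotalKoszul

/-! ## Koszul complexes of initial segments -/

section InitialSegments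

variable {A : Type*} [CommRing A] {M : Type*} [AddCommGroup M] [Module A M] {n : ℕ}

variable (A M n) in
/-- The degree `i` part of the Koszul complex of the first `k` elements of a sequence of length
`n`, as a submodule of the total Koszul complex of the whole sequence. -/
def initialChains (i k : ℕ) : Submodule A (Finset (Fin n) → M) :=
  Submodule.pi Set.univ fun S => if S.card = i ∧ ∀ j ∈ S, j.1 < k then ⊤ else ⊥

theorem mem_initialChains {i k : ℕ} {F : Finset (Fin n) → M} :
    F ∈ initialChains A M n i k ↔ ∀ S, F S ≠ 0 → S.card = i ∧ ∀ j ∈ S, j.1 < k := by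
  simp only [initialChains, Submodule.mem_pi, Set.mem_univ, true_imp_iff]
  refine forall_congr' fun S => ?_
  split_ifs with h
  · simp only [Submodule.mem_top, true_iff]
    exact fun _ => h
  · rw [Submodule.mem_bot, ne_eq, not_imp_comm]
    exact ⟨fun hF _ => hF, fun hF => hF h⟩

theorem initialChains_fg [Module.Finite A M] (i k : ℕ) : (initialChains A M n i k).FG :=
  Submodule.fg_pi fun S => by
    split_ifs
    exacts [Module.Finite.fg_top, Submodule.fg_bot]

theorem initialChains_mono {i k l : ℕ} (h : k ≤ l) :
    initialChains A M n i k ≤ initialChains A M n i l := by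
  intro F hF
  rw [mem_initialChains] at hF ⊢
  exact fun S hS => ⟨(hF S hS).1, fun j hj => ((hF S hS).2 j hj).trans_le h⟩

theorem initialChains_succ_zero (i : ℕ) : initialChains A M n (i + 1) 0 = ⊥ := by
  refine (Submodule.eq_bot_iff _).mpr fun F hF => funext fun S => ?_
  by_contra hS
  obtain ⟨hcard, hlt⟩ := mem_initialChains.mp hF S hS
  obtain ⟨j, hj⟩ := Finset.card_pos.mp (i.succ_pos.trans_eq hcard.symm)
  exact absurd (hlt j hj) (Nat.not_lt_zero _)

theorem single_mem_initialChains (k : ℕ) (m : M) :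
    Pi.single ∅ m ∈ initialChains A M n 0 k := by
  rw [mem_initialChains]
  intro S hS
  obtain rfl : S = ∅ := by
    by_contra h
    exact hS (Pi.single_eq_of_ne (M := fun _ => M) h m)
  simp

theorem eq_single_of_mem_initialChains_zero {k : ℕ} {F : Finset (Fin n) → M}
    (hF : F ∈ initialChains A M n 0 k) : F = Pi.single ∅ (F ∅) := by
  ext S
  rcases eq_or_ne S ∅ with rfl | hS
  · rw [Pi.single_eq_same]
  · rw [Pi.single_eq_of_ne hS]
    by_contra h
    exact hS (Finset.card_eq_zero.mp (mem_initialChains.mp hF S h).1)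

theorem koszulWedge_mem_initialChains {i k : ℕ} {F : Finset (Fin n) → M} {s : Fin n}
    (hs : s.1 < k) (hF : F ∈ initialChains A M n i k) :
    koszulWedge A s F ∈ initialChains A M n (i + 1) k := by
  rw [mem_initialChains] at hF ⊢
  intro S hS
  rw [koszulWedge_apply] at hS
  split_ifs at hS with h
  · obtain ⟨hcard, hlt⟩ := hF _ (right_ne_zero_of_smul hS)
    refine ⟨by rw [← Finset.card_erase_add_one h, hcard], fun j hj => ?_⟩
    rcases eq_or_ne j s with rfl | hjs
    · exact hs
    · exact hlt j (Finset.mem_erase.mpr ⟨hjs, hj⟩)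
  · exact absurd rfl hS

theorem koszulContract_mem_initialChains {i k : ℕ} {F : Finset (Fin n) → M} (s : Fin n)
    (hF : F ∈ initialChains A M n (i + 1) k) :
    koszulContract A s F ∈ initialChains A M n i k := by
  rw [mem_initialChains] at hF ⊢
  intro S hS
  rw [koszulContract_apply] at hS
  split_ifs at hS with h
  · exact absurd rfl hS
  · obtain ⟨hcard, hlt⟩ := hF _ (right_ne_zero_of_smul hS)
    rw [Finset.card_insert_of_notMem h] at hcard
    exact ⟨Nat.succ_injective hcard, fun j hj => hlt j (Finset.mem_insert_of_mem hj)⟩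

theorem koszulContract_eq_zero {i : ℕ} {s : Fin n} {F : Finset (Fin n) → M}
    (hF : F ∈ initialChains A M n i s) : koszulContract A s F = 0 := by
  ext S
  rw [koszulContract_apply, Pi.zero_apply]
  split_ifs
  · rfl
  · by_contra h
    exact ((mem_initialChains.mp hF _ (right_ne_zero_of_smul h)).2 s
      (Finset.mem_insert_self s S)).false

theorem koszulContract_mem_initialChains_self {i : ℕ} {s : Fin n} {F : Finset (Fin n) → M}
    (hF : F ∈ initialChains A M n (i + 1) (s.1 + 1)) :
    koszulContract A s F ∈ initialChains A M n i s := by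
  have hF' := mem_initialChains.mp (koszulContract_mem_initialChains s hF)
  rw [mem_initialChains]
  intro S hS
  refine ⟨(hF' S hS).1, fun j hj => lt_of_le_of_ne (Nat.lt_succ_iff.mp ((hF' S hS).2 j hj)) ?_⟩
  intro hjs
  exact hS (by rw [koszulContract_apply, if_pos (Fin.ext hjs ▸ hj)])

theorem sub_koszulWedge_koszulContract_mem {i : ℕ} {s : Fin n} {F : Finset (Fin n) → M}
    (hF : F ∈ initialChains A M n i (s.1 + 1)) :
    F - koszulWedge A s (koszulContract A s F) ∈ initialChains A M n i s := by
  rw [sub_eq_of_eq_add (koszulContract_koszulWedge_self s F).symm]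
  exact koszulContract_mem_initialChains_self
    (koszulWedge_mem_initialChains (Nat.lt_succ_self _) hF)

variable (x : Fin n → A)

theorem totalKoszulD_mem_initialChains {i k : ℕ} {F : Finset (Fin n) → M}
    (hF : F ∈ initialChains A M n (i + 1) k) : totalKoszulD x F ∈ initialChains A M n i k := by
  rw [totalKoszulD_apply]
  exact sum_mem fun s _ => Submodule.smul_mem _ _ (koszulContract_mem_initialChains s hF)

theorem totalKoszulD_single (m : M) :
    totalKoszulD x (Pi.single ∅ m : Finset (Fin n) → M) = 0 := by
  have h (s : Fin n) : koszulContract A s (Pi.single ∅ m : Finset (Fin n) → M) = 0 :=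
    koszulContract_eq_zero (initialChains_mono s.1.zero_le (single_mem_initialChains 0 m))
  simp only [totalKoszulD_apply, h, smul_zero, Finset.sum_const_zero]

theorem totalKoszulD_apply_empty (F : Finset (Fin n) → M) :
    totalKoszulD x F ∅ = ∑ s, x s • F {s} := by
  simp [totalKoszulD_apply, koszulContract_apply, alternatingSign]

/-- The cycles of degree `i` of the Koszul complex of `x₁, …, x_k` on `M`. -/
def initialCycles (x : Fin n → A) (M : Type*) [AddCommGroup M] [Module A M] (i k : ℕ) :
    Submodule A (Finset (Fin n) → M) :=
  initialChains A M n i k ⊓ LinearMap.ker (totalKoszulD x)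

/-- The boundaries of degree `i` of the Koszul complex of `x₁, …, x_k` on `M`. -/
def initialBoundaries (x : Fin n → A) (M : Type*) [AddCommGroup M] [Module A M] (i k : ℕ) :
    Submodule A (Finset (Fin n) → M) :=
  (initialChains A M n (i + 1) k).map (totalKoszulD x)

theorem initialBoundaries_mono {i k l : ℕ} (h : k ≤ l) :
    initialBoundaries x M i k ≤ initialBoundaries x M i l :=
  Submodule.map_mono (initialChains_mono h)

theorem smul_mem_initialBoundaries {i k : ℕ} {F : Finset (Fin n) → M}
    (hF : F ∈ initialCycles x M i k) {s : Fin n} (hs : s.1 < k) :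
    x s • F ∈ initialBoundaries x M i k := by
  refine ⟨_, koszulWedge_mem_initialChains hs hF.1, ?_⟩
  rw [totalKoszulD_koszulWedge, LinearMap.mem_ker.mp hF.2, map_zero, sub_zero]

theorem single_mem_initialBoundaries_iff (k : Fin n) (m : M) :
    Pi.single ∅ m ∈ initialBoundaries x M 0 k ↔ m ∈ initialIdeal x k • (⊤ : Submodule A M) := by
  constructor
  · rintro ⟨G, hG, hGm⟩
    rw [← Pi.single_eq_same (M := fun _ => M) (∅ : Finset (Fin n)) m, ← hGm,
      totalKoszulD_apply_empty]
    refine sum_mem fun s _ => ?_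
    by_cases hs : G {s} = 0
    · rw [hs, smul_zero]
      exact zero_mem _
    · exact Submodule.smul_mem_smul (Ideal.subset_span (Set.mem_image_of_mem x
        ((mem_initialChains.mp hG _ hs).2 s (Finset.mem_singleton_self s)))) trivial
  · suffices h : initialIdeal x k • (⊤ : Submodule A M) ≤
        (initialBoundaries x M 0 k).comap (LinearMap.single A (fun _ => M) ∅) from fun hm => h hm
    rw [initialIdeal, Submodule.span_smul_eq, Submodule.set_smul_le_iff]
    rintro _ m ⟨j, hj, rfl⟩ -
    rw [Submodule.mem_comap, map_smul]
    exact smul_mem_initialBoundaries x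
      ⟨single_mem_initialChains k m, totalKoszulD_single x m⟩ hj

/-- Contraction with the dual of `e_k` is the connecting map of the long exact sequence relating
the Koszul homologies of `x₁, …, x_k` and `x₁, …, x_{k+1}`. -/
theorem koszulContract_mem_initialCycles {i : ℕ} {k : Fin n} {F : Finset (Fin n) → M}
    (hF : F ∈ initialChains A M n (i + 1) (k.1 + 1))
    (hDF : koszulContract A k (totalKoszulD x F) = 0) :
    koszulContract A k F ∈ initialCycles x M i k :=
  ⟨koszulContract_mem_initialChains_self hF, LinearMap.mem_ker.mpr <| by
    rw [totalKoszulD_koszulContract, hDF, neg_zero]⟩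

theorem smul_koszulContract_mem_initialBoundaries {i : ℕ} {k : Fin n} {F : Finset (Fin n) → M}
    (hF : F ∈ initialCycles x M (i + 1) (k.1 + 1)) :
    x k • koszulContract A k F ∈ initialBoundaries x M i k := by
  have hDF := LinearMap.mem_ker.mp hF.2
  have h := totalKoszulD_sub_koszulWedge_koszulContract x (s := k) (F := F) (by rw [hDF, map_zero])
  rw [hDF, zero_sub] at h
  exact ⟨_, neg_mem (sub_koszulWedge_koszulContract_mem hF.1), by rw [map_neg, h, neg_neg]⟩

theorem koszulContract_mem_initialBoundaries {i : ℕ} {k : Fin n} {F : Finset (Fin n) → M}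
    (hF : F ∈ initialBoundaries x M (i + 1) (k.1 + 1)) :
    koszulContract A k F ∈ initialBoundaries x M i k := by
  obtain ⟨g, hg, rfl⟩ := hF
  exact ⟨_, neg_mem (koszulContract_mem_initialChains_self hg), by
    rw [map_neg, totalKoszulD_koszulContract, neg_neg]⟩

variable {x}

theorem mem_almostClosure_initialBoundaries_succ {v : ValueMap A} [v.IsNontrivial] {i : ℕ}
    {k : Fin n} {F : Finset (Fin n) → M} (hF : F ∈ initialCycles x M (i + 1) (k.1 + 1))
    (hcontract : koszulContract A k F ∈ almostClosure v (initialBoundaries x M i k))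
    (hk : initialCycles x M (i + 1) k ≤ almostClosure v (initialBoundaries x M (i + 1) k)) :
    F ∈ almostClosure v (initialBoundaries x M (i + 1) (k.1 + 1)) := by
  refine mem_almostClosure_of_smul_mem v fun ε hε => ?_
  obtain ⟨b, hb, g, hg, hgb⟩ := hcontract ε hε
  refine ⟨b, hb, ?_⟩
  have hDF := LinearMap.mem_ker.mp hF.2
  set F₀ := F - koszulWedge A k (koszulContract A k F)
  have hDF₀ : totalKoszulD x F₀ = -(x k • koszulContract A k F) := by
    rw [totalKoszulD_sub_koszulWedge_koszulContract x (by rw [hDF, map_zero]), hDF, zero_sub]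
  have hcycle : b • F₀ + x k • g ∈ initialCycles x M (i + 1) k := by
    refine ⟨add_mem (Submodule.smul_mem _ _ (sub_koszulWedge_koszulContract_mem hF.1))
      (Submodule.smul_mem _ _ hg), LinearMap.mem_ker.mpr ?_⟩
    rw [map_add, map_smul, map_smul, hDF₀, hgb, smul_neg, smul_comm, neg_add_cancel]
  have hbF : b • F = b • F₀ + x k • g - totalKoszulD x (koszulWedge A k g) := by
    rw [totalKoszulD_koszulWedge, hgb, map_smul, smul_sub]
    abel
  rw [hbF]
  exact sub_mem (almostClosure_mono v (initialBoundaries_mono x (Nat.le_succ k)) (hk hcycle))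
    (le_almostClosure v _ ⟨_, koszulWedge_mem_initialChains (Nat.lt_succ_self k)
      (initialChains_mono (Nat.le_succ k) hg), rfl⟩)

theorem initialCycles_le_almostClosure {v : ValueMap A} [v.IsNontrivial]
    (h : ∀ k, (initialIdeal x k • (⊤ : Submodule A M)).comap (LinearMap.lsmul A M (x k)) ≤
      almostClosure v (initialIdeal x k • ⊤)) {k : ℕ} (hk : k ≤ n) (i : ℕ) :
    initialCycles x M (i + 1) k ≤ almostClosure v (initialBoundaries x M (i + 1) k) := by
  induction k generalizing i with
  | zero =>
    rw [initialCycles, initialChains_succ_zero, bot_inf_eq]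
    exact bot_le
  | succ k ih =>
    obtain ⟨k, rfl⟩ : ∃ k' : Fin n, k'.1 = k := ⟨⟨k, hk⟩, rfl⟩
    refine fun F hF => mem_almostClosure_initialBoundaries_succ hF ?_ (ih k.2.le i)
    have hcycle := koszulContract_mem_initialCycles x hF.1
      (by rw [LinearMap.mem_ker.mp hF.2, map_zero])
    cases i with
    | succ i => exact ih k.2.le i hcycle
    | zero =>
      have hsmul := smul_koszulContract_mem_initialBoundaries x hF
      rw [eq_single_of_mem_initialChains_zero hcycle.1] at hsmul ⊢
      rw [← Pi.single_smul, single_mem_initialBoundaries_iff] at hsmul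
      exact map_mem_almostClosure v (LinearMap.single A (fun _ => M) ∅)
        (fun m => (single_mem_initialBoundaries_iff x k m).mpr) (h k hsmul)

/-- The long exact sequence bounds `H₁(x₁, …, x_k; M)` by `x_{k+1} H₁(x₁, …, x_k; M)` when
`H₁(x₁, …, x_{k+1}; M) = 0`, and Nakayama's lemma applies. -/
theorem initialCycles_one_le_of_le (hM : IsCoherentModule A M)
    (hx : ∀ j, x j ∈ Ideal.jacobson (⊥ : Ideal A))
    (h : initialCycles x M 1 n ≤ initialBoundaries x M 1 n) {k : ℕ} (hk : k ≤ n) :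
    initialCycles x M 1 k ≤ initialBoundaries x M 1 k := by
  have := hM.1
  induction hk using Nat.decreasingInduction with
  | self => exact h
  | of_succ k hk ih =>
    obtain ⟨k, rfl⟩ : ∃ k' : Fin n, k'.1 = k := ⟨⟨k, hk⟩, rfl⟩
    refine Submodule.le_of_le_smul_of_le_jacobson_bot (I := Ideal.span {x k})
      ((hM.pi _).fg_inf_ker (initialChains_fg 1 k) (totalKoszulD x))
      ((Ideal.span_singleton_le_iff_mem _).mpr (hx k)) ?_
    rintro f ⟨hf, hDf⟩
    obtain ⟨g, hg, rfl⟩ := ih ⟨initialChains_mono (Nat.le_succ k) hf, hDf⟩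
    have hcontract : koszulContract A k (totalKoszulD x g) = 0 := koszulContract_eq_zero hf
    rw [← sub_add_cancel (totalKoszulD x g) (x k • koszulContract A k g),
      ← totalKoszulD_sub_koszulWedge_koszulContract x hcontract]
    exact Submodule.add_mem_sup ⟨_, sub_koszulWedge_koszulContract_mem hg, rfl⟩
      (Submodule.smul_mem_smul (Ideal.mem_span_singleton_self _)
        (koszulContract_mem_initialCycles x hg hcontract))

theorem comap_lsmul_initialIdeal_le {k : Fin n}
    (h : initialCycles x M 1 (k.1 + 1) ≤ initialBoundaries x M 1 (k.1 + 1)) :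
    (initialIdeal x k • (⊤ : Submodule A M)).comap (LinearMap.lsmul A M (x k)) ≤
      initialIdeal x k • ⊤ := by
  intro m hm
  obtain ⟨G, hG, hDG⟩ := (single_mem_initialBoundaries_iff x k (x k • m)).mpr hm
  have hsingle := single_mem_initialChains (A := A) (n := n) k m
  have hcycle : koszulWedge A k (Pi.single ∅ m) - G ∈ initialCycles x M 1 (k.1 + 1) := by
    refine ⟨sub_mem (koszulWedge_mem_initialChains (Nat.lt_succ_self k)
      (initialChains_mono (Nat.le_succ k) hsingle)) (initialChains_mono (Nat.le_succ k) hG),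
      LinearMap.mem_ker.mpr ?_⟩
    rw [map_sub, totalKoszulD_koszulWedge, totalKoszulD_single, map_zero, sub_zero, hDG,
      Pi.single_smul, sub_self]
  have hcontract := koszulContract_mem_initialBoundaries x (h hcycle)
  have hwedge := koszulContract_koszulWedge_self (A := A) k (Pi.single ∅ m : Finset (Fin n) → M)
  rw [koszulContract_eq_zero hsingle, map_zero, add_zero] at hwedge
  rw [map_sub, koszulContract_eq_zero hG, sub_zero, hwedge] at hcontract
  exact (single_mem_initialBoundaries_iff x k m).mp hcontract

end InitialSegments

/-! ## Comparison with the graded Koszul complex -/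

section KoszulComparison

variable {A : Type*} [CommRing A] {M : Type*} [AddCommGroup M] [Module A M] {n : ℕ}

variable (A M n) in
/-- The inclusion of `K_i(x; M)` in the total Koszul complex, extending families by zero. -/
def koszulExt (i : ℕ) : KoszulChain n i M →ₗ[A] (Finset (Fin n) → M) :=
  LinearMap.pi fun S => if h : S.card = i then LinearMap.proj ⟨S, h⟩ else 0

theorem koszulExt_apply {i : ℕ} (f : KoszulChain n i M) (S : Finset (Fin n)) :
    koszulExt A M n i f S = if h : S.card = i then f ⟨S, h⟩ else 0 := by
  rw [koszulExt, LinearMap.pi_apply]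
  split_ifs <;> rfl

theorem koszulExt_injective (i : ℕ) : Function.Injective (koszulExt A M n i) := fun f g h =>
  funext fun S => by simpa only [koszulExt_apply, dif_pos S.2] using congrFun h S.1

theorem range_koszulExt (i : ℕ) :
    LinearMap.range (koszulExt A M n i) = initialChains A M n i n := by
  ext F
  rw [mem_initialChains]
  constructor
  · rintro ⟨f, rfl⟩ S hS
    rw [koszulExt_apply] at hS
    exact ⟨by_contra fun h => hS (dif_neg h), fun j _ => j.2⟩
  · refine fun hF => ⟨fun S => F S.1, funext fun S => ?_⟩
    rw [koszulExt_apply]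
    split_ifs with h
    · rfl
    · exact (by_contra fun hS => h (hF S (Ne.symm hS)).1)

variable (x : Fin n → A)

theorem koszulD_apply (i : ℕ) (f : KoszulChain n (i + 1) M)
    (S : {S : Finset (Fin n) // S.card = i}) :
    koszulD x M i f S = ∑ s : {s : Fin n // s ∉ S.1}, (alternatingSign A S.1 s * x s) •
      f ⟨insert s.1 S.1, by rw [Finset.card_insert_of_notMem s.2, S.2]⟩ := by
  simp only [koszulD, LinearMap.pi_apply, LinearMap.sum_apply, LinearMap.smul_apply,
    LinearMap.proj_apply]

theorem totalKoszulD_koszulExt (i : ℕ) (f : KoszulChain n (i + 1) M) :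
    totalKoszulD x (koszulExt A M n (i + 1) f) = koszulExt A M n i (koszulD x M i f) := by
  ext S
  rw [koszulExt_apply]
  split_ifs with hS
  · have hmem (s : {s // s ∈ S}) :
        x s • koszulContract A s.1 (koszulExt A M n (i + 1) f) S = 0 := by
      rw [koszulContract_apply, if_pos s.2, smul_zero]
    have hnotMem (s : {s // s ∉ S}) :
        x s • koszulContract A s.1 (koszulExt A M n (i + 1) f) S =
          (alternatingSign A S s * x s) •
            f ⟨insert s.1 S, by rw [Finset.card_insert_of_notMem s.2, hS]⟩ := by
      rw [koszulContract_apply, if_neg s.2, koszulExt_apply, dif_pos, smul_smul, mul_comm]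
    simp only [totalKoszulD_apply, Finset.sum_apply, Pi.smul_apply, koszulD_apply,
      ← Fintype.sum_subtype_add_sum_subtype (· ∈ S), hmem, hnotMem, Finset.sum_const_zero, zero_add]
  · have hf : koszulExt A M n (i + 1) f ∈ initialChains A M n (i + 1) n :=
      (range_koszulExt (i + 1)).le (LinearMap.mem_range_self _ f)
    by_contra h
    exact hS (mem_initialChains.mp (totalKoszulD_mem_initialChains x hf) S h).1

theorem koszulCycles_succ_eq_comap (i : ℕ) :
    koszulCycles x M (i + 1) = (initialCycles x M (i + 1) n).comap (koszulExt A M n (i + 1)) := by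
  ext f
  rw [koszulCycles, initialCycles, ← range_koszulExt, Submodule.mem_comap, Submodule.mem_inf,
    and_iff_right (LinearMap.mem_range_self _ f), LinearMap.mem_ker, LinearMap.mem_ker,
    totalKoszulD_koszulExt, map_eq_zero_iff _ (koszulExt_injective i)]

theorem range_koszulD_eq_comap (i : ℕ) :
    LinearMap.range (koszulD x M i) = (initialBoundaries x M i n).comap (koszulExt A M n i) := by
  have h : totalKoszulD x ∘ₗ koszulExt A M n (i + 1) = koszulExt A M n i ∘ₗ koszulD x M i :=
    LinearMap.ext (totalKoszulD_koszulExt x i)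
  rw [initialBoundaries, ← range_koszulExt, ← LinearMap.range_comp, h, LinearMap.range_comp,
    Submodule.comap_map_eq_of_injective (koszulExt_injective i)]

theorem isAlmostZero_koszulHomology {v : ValueMap A} [v.IsNontrivial] {i : ℕ}
    (h : initialCycles x M (i + 1) n ≤ almostClosure v (initialBoundaries x M (i + 1) n)) :
    IsAlmostZero v (KoszulHomology x M (i + 1)) := by
  rw [isAlmostZero_quotient_iff, koszulCycles_succ_eq_comap, range_koszulD_eq_comap]
  exact fun f hf ε hε => let ⟨b, hb, hbf⟩ := h hf ε hε
    ⟨b, hb, by rwa [Submodule.mem_comap, map_smul]⟩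

theorem initialCycles_le_initialBoundaries {i : ℕ}
    (h : koszulCycles x M (i + 1) ≤ LinearMap.range (koszulD x M (i + 1))) :
    initialCycles x M (i + 1) n ≤ initialBoundaries x M (i + 1) n := by
  rw [koszulCycles_succ_eq_comap, range_koszulD_eq_comap] at h
  intro F hF
  obtain ⟨f, rfl⟩ := (range_koszulExt (i + 1)).ge hF.1
  exact h hF

theorem smul_mem_range_koszulD {i : ℕ} {f : KoszulChain n (i + 1) M}
    (hf : f ∈ koszulCycles x M (i + 1)) (s : Fin n) :
    x s • f ∈ LinearMap.range (koszulD x M (i + 1)) := by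
  rw [koszulCycles_succ_eq_comap] at hf
  rw [range_koszulD_eq_comap, Submodule.mem_comap, map_smul]
  exact smul_mem_initialBoundaries x hf s.2

end KoszulComparison

/-! ## Koszul homology and Čech cohomology -/

section SubquotientSequences

variable {A : Type*} [CommRing A] {v : ValueMap A} [v.IsNontrivial] {n : ℕ} {y : Fin n → A}
  {M N : Type*} [AddCommGroup M] [Module A M] [AddCommGroup N] [Module A N] {q : ℕ}

theorem exact_subtype_ker_rangeRestrict (f : M →ₗ[A] N) :
    Function.Exact (LinearMap.ker f).subtype f.rangeRestrict := by
  rw [LinearMap.exact_iff, LinearMap.ker_rangeRestrict, Submodule.range_subtype]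

theorem exact_inclusion_mkQ_submoduleOf {L K : Submodule A M} (h : L ≤ K) :
    Function.Exact (Submodule.inclusion h) (L.submoduleOf K).mkQ := by
  rw [LinearMap.exact_iff, Submodule.ker_mkQ, Submodule.range_inclusion, Submodule.submoduleOf]

theorem CechAlmostInjective.subtype_zero (L : Submodule A M) :
    CechAlmostInjective v y L.subtype 0 :=
  .of_injective L.subtype_injective L.mkQ_surjective (LinearMap.exact_subtype_mkQ L)
    fun p hp => absurd hp p.succ_ne_zero

theorem CechAlmostInjective.subtype_ker {f : M →ₗ[A] N}
    (h : IsAlmostZero v (CechCohomology y (LinearMap.range f) q)) :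
    CechAlmostInjective v y (LinearMap.ker f).subtype (q + 1) :=
  .of_injective (Submodule.subtype_injective _) f.surjective_rangeRestrict
    (exact_subtype_ker_rangeRestrict f) fun _ hp => Nat.succ_injective hp ▸ h

theorem CechAlmostInjective.rangeRestrict {f : M →ₗ[A] N}
    (h : IsAlmostZero v (CechCohomology y (LinearMap.ker f) q)) :
    CechAlmostInjective v y f.rangeRestrict q :=
  .of_surjective (Submodule.subtype_injective _) f.surjective_rangeRestrict
    (exact_subtype_ker_rangeRestrict f) h

theorem isAlmostZero_cechCohomology_range {f : M →ₗ[A] N}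
    (hM : IsAlmostZero v (CechCohomology y M q))
    (hf : IsAlmostZero v (CechCohomology y (LinearMap.ker f) (q + 1))) :
    IsAlmostZero v (CechCohomology y (LinearMap.range f) q) :=
  isAlmostZero_cechCohomology_right (Submodule.subtype_injective _) f.surjective_rangeRestrict
    (exact_subtype_ker_rangeRestrict f) hM hf

variable {L K : Submodule A M}

theorem CechAlmostInjective.inclusion (h : L ≤ K) (hQ : IsAlmostZero v (K ⧸ L.submoduleOf K)) :
    CechAlmostInjective v y (Submodule.inclusion h) q :=
  .of_injective (Submodule.inclusion_injective h) (Submodule.mkQ_surjective _)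
    (exact_inclusion_mkQ_submoduleOf h) fun p _ => hQ.cechCohomology y p

theorem isAlmostZero_cechCohomology_of_le (h : L ≤ K) (hQ : IsAlmostZero v (K ⧸ L.submoduleOf K))
    (hL : IsAlmostZero v (CechCohomology y L q)) : IsAlmostZero v (CechCohomology y K q) :=
  (CechAlmostInjective.of_surjective (Submodule.inclusion_injective h)
    (Submodule.mkQ_surjective _) (exact_inclusion_mkQ_submoduleOf h) hL).isAlmostZero
      (hQ.cechCohomology y q)

theorem isAlmostZero_cechCohomology_quotient (h : L ≤ K)
    (hK : IsAlmostZero v (CechCohomology y K q))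
    (hL : IsAlmostZero v (CechCohomology y L (q + 1))) :
    IsAlmostZero v (CechCohomology y (K ⧸ L.submoduleOf K) q) :=
  isAlmostZero_cechCohomology_right (Submodule.inclusion_injective h) (Submodule.mkQ_surjective _)
    (exact_inclusion_mkQ_submoduleOf h) hK hL

end SubquotientSequences

section KoszulCech

variable {A : Type*} [CommRing A] {M : Type*} [AddCommGroup M] [Module A M] {n m : ℕ}

theorem koszulChain_subsingleton (M : Type*) [AddCommGroup M] {i : ℕ} (h : m < i) :
    Subsingleton (KoszulChain m i M) := by
  have : IsEmpty {S : Finset (Fin m) // S.card = i} :=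
    ⟨fun S => absurd (card_finset_fin_le S.1) (by rw [S.2]; exact h.not_ge)⟩
  infer_instance

theorem range_koszulD_le_koszulCycles (x : Fin m → A) (M : Type*) [AddCommGroup M] [Module A M]
    (i : ℕ) : LinearMap.range (koszulD x M i) ≤ koszulCycles x M i := by
  cases i with
  | zero => exact le_top
  | succ i =>
    rintro _ ⟨f, rfl⟩
    exact koszulD_koszulD x M i f

variable {v : ValueMap A} [v.IsNontrivial] {y : Fin n → A} {x : Fin m → A}

theorem cechAlmostInjective_subtype_range_koszulD {q i : ℕ} (hqi : q ≤ i)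
    (hH : ∀ i, IsAlmostZero v (KoszulHomology x M (i + 1)))
    (hM : ∀ p < q, IsAlmostZero v (CechCohomology y M p)) :
    CechAlmostInjective v y (LinearMap.range (koszulD x M i)).subtype q := by
  induction q generalizing i with
  | zero => exact .subtype_zero _
  | succ q ih =>
    obtain ⟨i, rfl⟩ := Nat.exists_eq_succ_of_ne_zero (Nat.ne_zero_of_lt hqi)
    have hrange : IsAlmostZero v (CechCohomology y (LinearMap.range (koszulD x M i)) q) :=
      (ih (Nat.le_of_succ_le_succ hqi) fun p hp => hM p (hp.trans q.lt_succ_self)).isAlmostZero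
        ((hM q q.lt_succ_self).cechCohomology_pi _)
    have hle : LinearMap.range (koszulD x M (i + 1)) ≤ LinearMap.ker (koszulD x M i) :=
      range_koszulD_le_koszulCycles x M (i + 1)
    have hincl : CechAlmostInjective v y (Submodule.inclusion hle) (q + 1) :=
      .inclusion hle (hH i)
    rw [← Submodule.subtype_comp_inclusion _ _ hle]
    exact (CechAlmostInjective.subtype_ker hrange).comp hincl

theorem cechAlmostInjective_koszulD_top {x : Fin (m + 1) → A} {q : ℕ} (hqm : q ≤ m)
    (hH : ∀ i, IsAlmostZero v (KoszulHomology x M (i + 1)))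
    (hM : ∀ p < q, IsAlmostZero v (CechCohomology y M p)) :
    CechAlmostInjective v y (koszulD x M m) q := by
  have hclosure : LinearMap.ker (koszulD x M m) ≤
      almostClosure v (LinearMap.range (koszulD x M (m + 1))) :=
    (isAlmostZero_quotient_iff (koszulCycles x M (m + 1)) _).mp (hH m)
  have hker : IsAlmostZero v (LinearMap.ker (koszulD x M m)) := fun z ε hε => by
    obtain ⟨b, hb, f, hf⟩ := hclosure z.2 ε hε
    have := koszulChain_subsingleton M (m + 1).lt_succ_self
    rw [Subsingleton.elim f 0, map_zero] at hf
    exact ⟨b, Subtype.ext hf.symm, hb⟩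
  rw [← LinearMap.subtype_comp_codRestrict (koszulD x M m) _ (LinearMap.mem_range_self _)]
  exact (cechAlmostInjective_subtype_range_koszulD hqm hH hM).comp
    (.rangeRestrict (hker.cechCohomology y q))

theorem mem_almostClosure_cechCoboundaries_of_smul_mem {r : ℕ} (hr : r < m)
    (hH : ∀ i, IsAlmostZero v (KoszulHomology x M (i + 1)))
    (hM : ∀ p < r, IsAlmostZero v (CechCohomology y M p)) {z : CechCochain y M r}
    (hz : z ∈ LinearMap.ker (cechD y M r)) (hxz : ∀ s, x s • z ∈ cechCoboundaries y M r) :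
    z ∈ almostClosure v (cechCoboundaries y M r) := by
  obtain ⟨m, rfl⟩ := Nat.exists_eq_succ_of_ne_zero (Nat.ne_zero_of_lt hr)
  let e : M →ₗ[A] KoszulChain (m + 1) (m + 1) M := LinearMap.pi fun _ => LinearMap.id
  have he : CechAlmostInjective v y e r := fun z _ hez => by
    have h := cechMap_mem_almostClosure (LinearMap.proj
      ⟨Finset.univ, Finset.card_fin (m + 1)⟩ : KoszulChain (m + 1) (m + 1) M →ₗ[A] M) hez
    rwa [← cechMap_comp, show LinearMap.proj _ ∘ₗ e = LinearMap.id from rfl, cechMap_id] at h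
  refine ((cechAlmostInjective_koszulD_top (Nat.le_of_lt_succ hr) hH hM).comp he) z hz ?_
  refine mem_almostClosure_cechCoboundaries_pi fun S => le_almostClosure v _ ?_
  have hcomp : LinearMap.proj S ∘ₗ koszulD x M m ∘ₗ e =
      (∑ s : {s // s ∉ S.1}, alternatingSign A S.1 s * x s) • LinearMap.id := by
    ext a
    simp only [LinearMap.comp_apply, LinearMap.proj_apply, koszulD_apply, Finset.sum_smul,
      LinearMap.smul_apply, LinearMap.id_apply, LinearMap.sum_apply]
    rfl
  rw [← cechMap_comp, hcomp, map_smul, LinearMap.smul_apply, cechMap_id, Finset.sum_smul]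
  exact sum_mem fun s _ => by
    rw [mul_smul]
    exact Submodule.smul_mem _ _ (hxz s)

theorem exists_pow_smul_mem_cechCoboundaries_of_mem_radical {r : ℕ} {z : CechCochain y M r}
    (hz : z ∈ LinearMap.ker (cechD y M r)) {a : A}
    (ha : a ∈ (Ideal.span (Set.range y)).radical) :
    ∃ N : ℕ, a ^ N • z ∈ cechCoboundaries y M r := by
  suffices h : Ideal.span (Set.range y) ≤ Ideal.radical
      ((cechCoboundaries y M r).comap (LinearMap.toSpanSingleton A _ z)) from
    Ideal.radical_le_radical_iff.mpr h ha
  rw [Ideal.span_le]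
  rintro _ ⟨s, rfl⟩
  exact exists_pow_smul_mem_cechCoboundaries hz s

theorem isAlmostZero_cechCohomology_of_koszulHomology
    (hxy : ∀ j, x j ∈ (Ideal.span (Set.range y)).radical)
    (hH : ∀ t ≠ 0, ∀ i, IsAlmostZero v (KoszulHomology (fun j => x j ^ t) M (i + 1)))
    {r : ℕ} (hr : r < m) : IsAlmostZero v (CechCohomology y M r) := by
  induction r using Nat.strong_induction_on with
  | _ r ih =>
    refine isAlmostZero_cechCohomology_iff.mpr fun z hz => ?_
    have hpow : ∀ j, ∃ N : ℕ, x j ^ N • z ∈ cechCoboundaries y M r := fun j =>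
      exists_pow_smul_mem_cechCoboundaries_of_mem_radical hz (hxy j)
    choose N hN using hpow
    let t := Finset.univ.sup N + 1
    refine mem_almostClosure_cechCoboundaries_of_smul_mem hr (hH t (Nat.succ_ne_zero _))
      (fun p hp => ih p hp (hp.trans hr)) hz fun j => ?_
    have hNt : N j ≤ t := (Finset.le_sup (Finset.mem_univ j)).trans (Nat.le_succ _)
    rw [← Nat.sub_add_cancel hNt, pow_add, mul_smul]
    exact Submodule.smul_mem _ _ (hN j)

theorem isAlmostZero_koszulHomology_of_range
    (hyx : ∀ s, y s ∈ (Ideal.span (Set.range x)).radical) {i : ℕ}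
    (hM : IsAlmostZero v (CechCohomology y M 0))
    (hrange : IsAlmostZero v (CechCohomology y (LinearMap.range (koszulD x M (i + 1))) 1)) :
    IsAlmostZero v (KoszulHomology x M (i + 1)) := by
  have hZ : IsAlmostZero v (CechCohomology y (koszulCycles x M (i + 1)) 0) :=
    (CechAlmostInjective.subtype_zero _).isAlmostZero (hM.cechCohomology_pi _)
  refine isAlmostZero_of_cechCohomology_zero (isAlmostZero_cechCohomology_quotient
    (range_koszulD_le_koszulCycles x M (i + 1)) hZ hrange) fun a s => ?_
  suffices h : Ideal.span (Set.range x) ≤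
      LinearMap.ker (LinearMap.toSpanSingleton A (KoszulHomology x M (i + 1)) a) by
    obtain ⟨N, hN⟩ := hyx s
    exact ⟨N, h hN⟩
  rw [Ideal.span_le]
  rintro _ ⟨j, rfl⟩
  obtain ⟨f, rfl⟩ := Submodule.Quotient.mk_surjective _ a
  rw [SetLike.mem_coe, LinearMap.mem_ker, LinearMap.toSpanSingleton_apply,
    ← Submodule.Quotient.mk_smul, Submodule.Quotient.mk_eq_zero]
  exact smul_mem_range_koszulD x f.2 j

theorem isAlmostZero_cechCohomology_range_koszulD
    (hyx : ∀ s, y s ∈ (Ideal.span (Set.range x)).radical)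
    (hM : ∀ q < m, IsAlmostZero v (CechCohomology y M q)) {i : ℕ} (hi : i ≤ m) {q : ℕ}
    (hq : q ≤ i) : IsAlmostZero v (CechCohomology y (LinearMap.range (koszulD x M i)) q) := by
  induction hi using Nat.decreasingInduction generalizing q with
  | self =>
    have := koszulChain_subsingleton M m.lt_succ_self
    have := (koszulD x M m).surjective_rangeRestrict.subsingleton
    have hzero : IsAlmostZero v (LinearMap.range (koszulD x M m)) :=
      fun _ ε hε => ⟨1, Subsingleton.elim _ _, v.map_one_lt hε⟩
    exact hzero.cechCohomology y q
  | of_succ i hi ih =>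
    have hH : IsAlmostZero v (KoszulHomology x M (i + 1)) :=
      isAlmostZero_koszulHomology_of_range hyx (hM 0 (Nat.zero_lt_of_lt hi)) (ih (by omega))
    exact isAlmostZero_cechCohomology_range ((hM q (hq.trans_lt hi)).cechCohomology_pi _)
      (isAlmostZero_cechCohomology_of_le (range_koszulD_le_koszulCycles x M (i + 1)) hH
        (ih (Nat.succ_le_succ hq)))

theorem isAlmostZero_koszulHomology_of_cechCohomology
    (hyx : ∀ s, y s ∈ (Ideal.span (Set.range x)).radical)
    (hM : ∀ q < m, IsAlmostZero v (CechCohomology y M q)) (i : ℕ) :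
    IsAlmostZero v (KoszulHomology x M (i + 1)) := by
  rcases Nat.lt_or_ge i m with hi | hi
  · exact isAlmostZero_koszulHomology_of_range hyx (hM 0 (Nat.zero_lt_of_lt hi))
      (isAlmostZero_cechCohomology_range_koszulD hyx hM hi (Nat.succ_le_succ i.zero_le))
  · have := koszulChain_subsingleton M (Nat.lt_succ_of_le hi)
    have := (Submodule.mkQ_surjective
      ((LinearMap.range (koszulD x M (i + 1))).submoduleOf (koszulCycles x M (i + 1)))).subsingleton
    exact fun _ ε hε => ⟨1, Subsingleton.elim _ _, v.map_one_lt hε⟩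

end KoszulCech

/-! ## Systems of parameters and regular sequences -/

section SystemsOfParameters

variable {R : Type*} [CommRing R] [IsLocalRing R] {d : ℕ}

theorem exists_isSystemOfParameters [IsNoetherianRing R] (hd : ringKrullDim R = d) :
    ∃ x : Fin d → R, IsSystemOfParameters x := by
  obtain ⟨s, hs, hcard⟩ :=
    (IsLocalRing.maximalIdeal R).exists_finset_card_eq_height_of_isNoetherianRing
  have hsd : s.card = d := by
    have h := IsLocalRing.maximalIdeal_height_eq_ringKrullDim (R := R)
    rw [hd, ← hcard] at h
    exact_mod_cast h
  let e := s.equivFinOfCardEq hsd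
  refine ⟨fun i => e.symm i, hd, ?_⟩
  have hrange : Set.range (fun i => (e.symm i : R)) = s := by
    rw [← Function.comp_def, e.symm.surjective.range_comp, Subtype.range_coe]
  rw [hrange]
  refine le_antisymm ((IsLocalRing.maximalIdeal.isMaximal R).isPrime.radical_le_iff.mpr hs.1.2) ?_
  rw [Ideal.radical_eq_sInf]
  exact le_sInf fun p ⟨hp, hp'⟩ => hs.2 ⟨hp', hp⟩ (IsLocalRing.le_maximalIdeal hp'.ne_top)

variable {x : Fin d → R}

theorem IsSystemOfParameters.mem_maximalIdeal (hx : IsSystemOfParameters x) (i : Fin d) :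
    x i ∈ IsLocalRing.maximalIdeal R := by
  rw [← hx.2]
  exact Ideal.le_radical (Ideal.subset_span ⟨i, rfl⟩)

theorem IsSystemOfParameters.pow (hx : IsSystemOfParameters x) {t : ℕ} (ht : t ≠ 0) :
    IsSystemOfParameters (fun i => x i ^ t) := by
  refine ⟨hx.1, le_antisymm ?_ ?_⟩
  · rw [(IsLocalRing.maximalIdeal.isMaximal R).isPrime.radical_le_iff, Ideal.span_le]
    rintro _ ⟨i, rfl⟩
    exact Ideal.pow_mem_of_mem _ (hx.mem_maximalIdeal i) t (Nat.pos_of_ne_zero ht)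
  · rw [← hx.2, Ideal.radical_le_radical_iff, Ideal.span_le]
    rintro _ ⟨i, rfl⟩
    exact ⟨t, Ideal.subset_span ⟨i, rfl⟩⟩

theorem IsStrict.map_maximalIdeal_ne_top {B : Type*} [CommRing B] [Algebra R B]
    (hB : IsStrict R B) : (IsLocalRing.maximalIdeal R).map (algebraMap R B) ≠ ⊤ := fun h =>
  hB (by rw [Ideal.smul_top_eq_map, h]; rfl)

end SystemsOfParameters

section RegularSequences

variable {A : Type*} {d : ℕ}

theorem setOf_mem_take_ofFn (x : Fin d → A) (i : Fin d) :
    {a | a ∈ (List.ofFn x).take i} = x '' {j | j < i} := by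
  ext a
  rw [Set.mem_ofPred_eq, List.mem_take_iff_getElem]
  constructor
  · rintro ⟨j, hj, rfl⟩
    rw [List.length_ofFn, lt_min_iff] at hj
    exact ⟨⟨j, hj.2⟩, hj.1, by rw [List.getElem_ofFn]⟩
  · rintro ⟨j, hj, rfl⟩
    exact ⟨j, by rw [List.length_ofFn]; exact lt_min hj j.2, by rw [List.getElem_ofFn]⟩

variable [CommRing A] {M : Type*} [AddCommGroup M] [Module A M] {x : Fin d → A}

theorem isWeaklyRegular_ofFn
    (h : ∀ k, (initialIdeal x k • (⊤ : Submodule A M)).comap (LinearMap.lsmul A M (x k)) ≤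
      initialIdeal x k • ⊤) :
    RingTheory.Sequence.IsWeaklyRegular M (List.ofFn x) := by
  refine ⟨fun i hi => ?_⟩
  rw [List.length_ofFn] at hi
  rw [List.getElem_ofFn, Ideal.ofList, setOf_mem_take_ofFn x ⟨i, hi⟩,
    isSMulRegular_quotient_iff_mem_of_smul_mem]
  exact fun m hm => h ⟨i, hi⟩ hm

/-- The module `((x₁, …, x_{i-1}) M :_M x_i) / (x₁, …, x_{i-1}) M`, which is `ColonQuotient x i`
for `M = A`. -/
abbrev ModuleColonQuotient (x : Fin d → A) (M : Type*) [AddCommGroup M] [Module A M]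
    (i : Fin d) : Type _ :=
  ↥((initialIdeal x i • (⊤ : Submodule A M)).comap (LinearMap.lsmul A M (x i))) ⧸
    (initialIdeal x i • (⊤ : Submodule A M)).submoduleOf
      ((initialIdeal x i • (⊤ : Submodule A M)).comap (LinearMap.lsmul A M (x i)))

theorem isAlmostZero_moduleColonQuotient_self_iff {v : ValueMap A} [v.IsNontrivial] {i : Fin d} :
    IsAlmostZero v (ModuleColonQuotient x A i) ↔ IsAlmostZero v (ColonQuotient x i) := by
  have hcolon : Submodule.comap (LinearMap.lsmul A A (x i)) (initialIdeal x i) =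
      (initialIdeal x i).colon {x i} := by
    ext a
    rw [Submodule.mem_colon_singleton, Submodule.mem_comap, LinearMap.lsmul_apply, smul_eq_mul,
      smul_eq_mul, mul_comm]
  rw [isAlmostZero_quotient_iff, isAlmostZero_quotient_iff, smul_eq_mul, Ideal.mul_top, hcolon]

end RegularSequences

/-! ## Almost regularity, almost vanishing and regularity -/

section Modules

variable {A : Type*} [CommRing A] {M : Type*} [AddCommGroup M] [Module A M] {v : ValueMap A}
  [v.IsNontrivial] {m n : ℕ} {x : Fin m → A} {y : Fin n → A}

theorem isAlmostZero_koszulHomology_of_moduleColonQuotient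
    (h : ∀ k, IsAlmostZero v (ModuleColonQuotient x M k)) (i : ℕ) :
    IsAlmostZero v (KoszulHomology x M (i + 1)) :=
  isAlmostZero_koszulHomology x (initialCycles_le_almostClosure
    (fun k => (isAlmostZero_quotient_iff _ _).mp (h k)) le_rfl i)

theorem isWeaklyRegular_ofFn_of_cechCohomology (hv : v.IsNormalized) (hM : IsCoherentModule A M)
    (hx : ∀ j, x j ∈ Ideal.jacobson (⊥ : Ideal A))
    (hyx : ∀ s, y s ∈ (Ideal.span (Set.range x)).radical)
    (h : ∀ q < m, IsAlmostZero v (CechCohomology y M q)) :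
    RingTheory.Sequence.IsWeaklyRegular M (List.ofFn x) := by
  have := hM.1
  have hrange : (LinearMap.range (koszulD x M 1)).FG := Module.Finite.iff_fg.mp inferInstance
  have hexact : koszulCycles x M 1 ≤ LinearMap.range (koszulD x M 1) :=
    ((isAlmostZero_quotient_iff _ _).mp
      (isAlmostZero_koszulHomology_of_cechCohomology hyx h 0)).trans
      ((hM.pi _).almostClosure_le hv hrange)
  exact isWeaklyRegular_ofFn fun k => comap_lsmul_initialIdeal_le
    (initialCycles_one_le_of_le hM hx (initialCycles_le_initialBoundaries x hexact) k.2)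

end Modules

section LocalRing

theorem map_mem_radical_span {R S : Type*} [CommRing R] [CommRing S] (f : R →+* S) {ι : Type*}
    {z : ι → R} {a : R} (h : a ∈ (Ideal.span (Set.range z)).radical) :
    f a ∈ (Ideal.span (Set.range fun i => f (z i))).radical := by
  have h' := Ideal.map_radical_le f (Ideal.mem_map_of_mem f h)
  rwa [Ideal.map_span, ← Set.range_comp] at h'

variable {R : Type*} [CommRing R] [IsLocalRing R] {B : Type*} [CommRing B] [Algebra R B]
  {M : Type*} [AddCommGroup M] [Module R M] [Module B M] [IsScalarTower R B M]

theorem isRegular_ofFn_of_isWeaklyRegular (hM : IsStrict R M) {d : ℕ} {x : Fin d → R}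
    (hx : ∀ i, x i ∈ IsLocalRing.maximalIdeal R)
    (h : RingTheory.Sequence.IsWeaklyRegular M (List.ofFn fun i => algebraMap R B (x i))) :
    RingTheory.Sequence.IsRegular M (List.ofFn x) := by
  refine ⟨?_, fun htop => hM (top_le_iff.mp (htop.le.trans
    (Submodule.smul_mono_left (Ideal.span_le.mpr fun r hr => ?_))))⟩
  · rwa [← RingTheory.Sequence.isWeaklyRegular_map_algebraMap_iff B, List.map_ofFn]
  · obtain ⟨i, rfl⟩ := (List.mem_ofFn' _ _).mp hr
    exact hx i

theorem proposition5p5_general [IsNoetherianRing R] {d : ℕ} (hd : ringKrullDim R = d)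
    (v : ValueMap B) [v.IsNontrivial] {n : ℕ} (y : Fin n → R)
    (hy : (Ideal.span (Set.range y)).radical = IsLocalRing.maximalIdeal R) :
    ((∀ x : Fin d → R, IsSystemOfParameters x →
        ∀ i : Fin d, IsAlmostZero v (ModuleColonQuotient (fun j => algebraMap R B (x j)) M i)) →
      ∀ x : Fin d → R, IsSystemOfParameters x →
        ∀ i : ℕ, 0 < i → IsAlmostZero v (KoszulHomology (fun j => algebraMap R B (x j)) M i)) ∧
    ((∀ x : Fin d → R, IsSystemOfParameters x →
        ∀ i : ℕ, 0 < i → IsAlmostZero v (KoszulHomology (fun j => algebraMap R B (x j)) M i)) →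
      ∀ i : ℕ, i < d → IsAlmostZero v (CechCohomology (fun j => algebraMap R B (y j)) M i)) ∧
    (IsStrict R M → v.IsNormalized →
      (IsLocalRing.maximalIdeal R).map (algebraMap R B) ≤ Ideal.jacobson ⊥ →
      IsCoherentModule B M →
      (∀ i : ℕ, i < d → IsAlmostZero v (CechCohomology (fun j => algebraMap R B (y j)) M i)) →
      IsBalancedBigCohenMacaulay R M) := by
  refine ⟨fun h x hx i hi => ?_, fun h i hi => ?_, fun hM hn hjac hcoh h => ⟨hM, fun d' x hx => ?_⟩⟩
  · obtain ⟨i, rfl⟩ := Nat.exists_eq_succ_of_ne_zero hi.ne'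
    exact isAlmostZero_koszulHomology_of_moduleColonQuotient (h x hx) i
  · obtain ⟨x, hx⟩ := exists_isSystemOfParameters hd
    refine isAlmostZero_cechCohomology_of_koszulHomology
      (fun j => map_mem_radical_span _ (hy ▸ hx.mem_maximalIdeal j)) (fun t ht i => ?_) hi
    have hpow : (fun j => algebraMap R B (x j ^ t)) = fun j => algebraMap R B (x j) ^ t :=
      funext fun j => map_pow _ _ _
    exact hpow ▸ h _ (hx.pow ht) (i + 1) i.succ_pos
  · obtain rfl : d' = d := Nat.cast_injective (hx.1.symm.trans hd)
    have hy_mem (s : Fin n) : y s ∈ IsLocalRing.maximalIdeal R :=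
      hy ▸ Ideal.le_radical (Ideal.subset_span ⟨s, rfl⟩)
    exact isRegular_ofFn_of_isWeaklyRegular hM hx.mem_maximalIdeal
      (isWeaklyRegular_ofFn_of_cechCohomology hn hcoh
        (fun j => hjac (Ideal.mem_map_of_mem _ (hx.mem_maximalIdeal j)))
        (fun s => map_mem_radical_span _ (hx.2 ▸ hy_mem s)) h)

end LocalRing

theorem proposition5p5
    {R : Type u} [CommRing R] [IsNoetherianRing R] [IsLocalRing R]
    {B : Type w} [CommRing B] [Algebra R B] (hB : IsStrict R B)
    (d : ℕ) (hd : ringKrullDim R = d)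
    (v : ValueMap B) (hv : ∃ b : B, v b ≠ ⊤)
    -- local cohomology at the maximal ideal is computed by the Čech complex
    -- on any finite sequence `y` of generators of the maximal ideal
    {n : ℕ} (y : Fin n → R) (hy : Ideal.span (Set.range y) = IsLocalRing.maximalIdeal R) :
    -- (a) implies (b)
    ((∀ x : Fin d → R, IsSystemOfParameters x →
        ∀ i : Fin d, IsAlmostZero v (ColonQuotient (fun j => algebraMap R B (x j)) i)) →
      ∀ x : Fin d → R, IsSystemOfParameters x →
        ∀ i : ℕ, 0 < i → IsAlmostZero v (KoszulHomology (fun j => algebraMap R B (x j)) B i)) ∧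
    -- (b) implies (c)
    ((∀ x : Fin d → R, IsSystemOfParameters x →
        ∀ i : ℕ, 0 < i → IsAlmostZero v (KoszulHomology (fun j => algebraMap R B (x j)) B i)) →
      ∀ i : ℕ, i < d → IsAlmostZero v (CechCohomology (fun j => algebraMap R B (y j)) B i)) ∧
    -- (c) implies balanced big Cohen-Macaulay, under the additional hypotheses
    (v.IsNormalized → IsLocalRing B → IsCoherentRing B →
      (∀ i : ℕ, i < d → IsAlmostZero v (CechCohomology (fun j => algebraMap R B (y j)) B i)) →
      IsBalancedBigCohenMacaulay R B) := by
  have : v.IsNontrivial := ⟨hv⟩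
  have hradical : (Ideal.span (Set.range y)).radical = IsLocalRing.maximalIdeal R := by
    rw [hy, (IsLocalRing.maximalIdeal.isMaximal R).isPrime.isRadical.radical]
  obtain ⟨hab, hbc, hc⟩ := proposition5p5_general (M := B) hd v y hradical
  refine ⟨fun h => hab fun x hx i => isAlmostZero_moduleColonQuotient_self_iff.mpr (h x hx i), hbc,
    fun hn _ hcoh => hc hB hn ?_ hcoh⟩
  rw [IsLocalRing.jacobson_eq_maximalIdeal ⊥ bot_ne_top]
  exact IsLocalRing.le_maximalIdeal hB.map_maximalIdeal_ne_top
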